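/- Let $\Bbbk$ be a unital commutative ring in which $2$ is invertible, let $R=R_{\bar 0}\oplus R_{\bar 1}$ be a unital associative superalgebra over $\Bbbk$ (a $\mathbb{Z}/2\mathbb{Z}$-graded associative $\Bbbk$-algebra), and let $n\geqslant 3$. Let $\rho:R\to R$ be the $\Bbbk$-linear map with $\rho(a)=(-1)^{|a|}a$ for homogeneous $a$, applied entrywise to matrices. Let $\mathfrak{gl}_{n|n}(R)$ be the algebra of $2n\times 2n$ matrices over $R$, in which the matrix unit $e_{ij}(a)$ has parity $|i|+|j|+|a|$ with $|i|=\bar 0$ for $i\leqslant n$ and $|i|=\bar 1$ for $i>n$, regarded as a Lie superalgebra under the supercommutator $[X,Y]=XY-(-1)^{|X||Y|}YX$. Let $$\mathfrak{q}_n(R)=\left\{\begin{pmatrix}A&B\\ \rho(B)&\rho(A)\end{pmatrix}\ \middle|\ A,B\in \mathrm{M}_n(R)\right\}\subseteq\mathfrak{gl}_{n|n}(R),\qquad \mathfrak{sq}_n(R)=[\mathfrak{q}_n(R),\mathfrak{q}_n(R)]$$ be the queer and the special queer Lie superalgebra. Let $I_R\subseteq R\otimes_{\Bbbk} R$ be the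 $\Bbbk$-submodule generated by $$a\otimes b+(-1)^{|a||b|}b\otimes a\quad\text{and}\quad (-1)^{|a||c|}ab\otimes c+(-1)^{|b||a|}bc\otimes a+(-1)^{|c||b|}ca\otimes b$$ for homogeneous $a,b,c\in R$, and let the first $\mathbb{Z}/2\mathbb{Z}$-graded cyclic homology $\mathrm{HC}_1(R)$ be the kernel of the map $(R\otimes R)/I_R\to R$ induced by $a\otimes b\mapsto[a,b]=ab-(-1)^{|a||b|}ba$, with the induced $\mathbb{Z}/2\mathbb{Z}$-grading. For a Lie superalgebra $L$ over $\Bbbk$, let $\Lambda^2L$ be the quotient of $L\otimes L$ by the elements $x\otimes y+(-1)^{|x||y|}y\otimes x$ ($x,y$ homogeneous). Let the second homology $\mathrm{H}_2(L)$ of $L$ with trivial coefficients be the kernel of $\Lambda^2L\to L$, $x\wedge y\mapsto[x,y]$, modulo the $\Bbbk$-submodule generated by $$(-1)^{|x||z|}[x,y]\wedge z+(-1)^{|y||x|}[y,z]\wedge x+(-1)^{|z||y|}[z,x]\wedge y\quad (x,y,z\text{ homogeneous})\quad\text{and}\quad [x,x]\wedge x\quad(x\text{ odd}),$$ with the induced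 $\mathbb{Z}/2\mathbb{Z}$-grading. (The generators $[x,x]\wedge x$ are redundant if $3$ is invertible in $\Bbbk$. Lie superalgebras are understood to satisfy $[x,[x,x]]=0$ for odd $x$.) Then there is an isomorphism of $\mathbb{Z}/2\mathbb{Z}$-graded $\Bbbk$-modules $$\mathrm{H}_2(\mathfrak{sq}_n(R))\cong\mathrm{HC}_1(R)\otimes\Bbbk^{0|1},$$ where $\Bbbk^{0|1}$ is the module $\Bbbk$ placed in odd degree. That is, $\mathrm{H}_2(\mathfrak{sq}_n(R))$ is $\mathrm{HC}_1(R)$ with its even and odd parts exchanged. -/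

import Mathlib

open scoped TensorProduct

noncomputable section

/-! ## Signs and gradings

Everything is graded by `ZMod 2`; the base ring is meant to have `2` invertible. -/

/-- The sign `(-1)^{|x||y|}` for `|x| = i`, `|y| = j`. -/
def koszulSign (k : Type*) [CommRing k] (i j : ZMod 2) : k :=
  (-1) ^ (i.val * j.val)

/-- The `ZMod 2`-grading of a tensor product: the part of degree `i` is spanned by the `x ⊗ y`
with `x`, `y` homogeneous and `|x| + |y| = i`. -/
def superTensorGrading {k M N : Type*} [CommRing k] [AddCommGroup M] [Module k M]
    [AddCommGroup N] [Module k N] (ℳ : ZMod 2 → Submodule k M) (𝒩 : ZMod 2 → Submodule k N)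
    (i : ZMod 2) : Submodule k (M ⊗[k] N) :=
  Submodule.span k {t | ∃ a b : ZMod 2, a + b = i ∧ ∃ x ∈ ℳ a, ∃ y ∈ 𝒩 b, t = x ⊗ₜ[k] y}

/-- The graded module `k^{0|1}`: the module `k`, placed in odd degree. -/
def oddLine (k : Type*) [CommRing k] (i : ZMod 2) : Submodule k k :=
  if i = 1 then ⊤ else ⊥

/-! ## Associative superalgebras and their supercommutator -/

section Associative

variable {k A : Type*} [CommRing k] [Ring A] [Algebra k A]
  (𝒜 : ZMod 2 → Submodule k A) [GradedAlgebra 𝒜]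

/-- The bilinear supercommutator, `[x, y] = x y - (-1)^{|x||y|} y x` on homogeneous elements. -/
def superCommutator : A →ₗ[k] A →ₗ[k] A :=
  LinearMap.mul k A - ∑ i : ZMod 2, ∑ j : ZMod 2, koszulSign k i j •
    (LinearMap.mul k A).flip.compl₁₂ (GradedAlgebra.proj 𝒜 i) (GradedAlgebra.proj 𝒜 j)

/-- The linear map `ρ` with `ρ(a) = (-1)^{|a|} a` for homogeneous `a`. -/
def parityMap : A →ₗ[k] A :=
  GradedAlgebra.proj 𝒜 0 - GradedAlgebra.proj 𝒜 1

theorem proj_of_mem {i : ZMod 2} {x : A} (hx : x ∈ 𝒜 i) (j : ZMod 2) :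
    GradedAlgebra.proj 𝒜 j x = if j = i then x else 0 := by
  split_ifs with h
  · subst h
    exact DirectSum.decompose_of_mem_same 𝒜 hx
  · exact DirectSum.decompose_of_mem_ne 𝒜 hx (fun e => h e.symm)

theorem proj_mem (i : ZMod 2) (x : A) : GradedAlgebra.proj 𝒜 i x ∈ 𝒜 i :=
  (DirectSum.decompose 𝒜 x i).2

theorem zmod_two_cases (i : ZMod 2) : i = 0 ∨ i = 1 := by
  revert i; decide

theorem proj_add_proj (x : A) :
    GradedAlgebra.proj 𝒜 0 x + GradedAlgebra.proj 𝒜 1 x = x := by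
  induction x using DirectSum.Decomposition.inductionOn 𝒜 with
  | zero => simp
  | homogeneous m =>
    rename_i i
    rw [proj_of_mem 𝒜 m.2, proj_of_mem 𝒜 m.2]
    rcases zmod_two_cases i with rfl | rfl <;> simp
  | add a b ha hb => rw [map_add, map_add, add_add_add_comm, ha, hb]

theorem superCommutator_of_mem {i j : ZMod 2} {x y : A} (hx : x ∈ 𝒜 i) (hy : y ∈ 𝒜 j) :
    superCommutator 𝒜 x y = x * y - koszulSign k i j • (y * x) := by
  simp only [superCommutator, LinearMap.sub_apply, LinearMap.mul_apply', LinearMap.sum_apply,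
    LinearMap.smul_apply, LinearMap.compl₁₂_apply, LinearMap.flip_apply, proj_of_mem 𝒜 hx,
    proj_of_mem 𝒜 hy]
  congr 1
  rw [Finset.sum_eq_single i, Finset.sum_eq_single j]
  · simp
  · intro b _ hb; simp [hb]
  · simp
  · intro b _ hb; simp [hb]
  · simp

theorem parityMap_of_mem_zero {x : A} (hx : x ∈ 𝒜 0) : parityMap 𝒜 x = x := by
  simp [parityMap, -GradedAlgebra.proj_apply, proj_of_mem 𝒜 hx]

theorem parityMap_of_mem_one {x : A} (hx : x ∈ 𝒜 1) : parityMap 𝒜 x = -x := by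
  simp [parityMap, -GradedAlgebra.proj_apply, proj_of_mem 𝒜 hx]

theorem superCommutator_mem {i j : ZMod 2} {x y : A} (hx : x ∈ 𝒜 i) (hy : y ∈ 𝒜 j) :
    superCommutator 𝒜 x y ∈ 𝒜 (i + j) := by
  rw [superCommutator_of_mem 𝒜 hx hy]
  exact sub_mem (SetLike.mul_mem_graded hx hy)
    (Submodule.smul_mem _ _ (add_comm j i ▸ SetLike.mul_mem_graded hy hx))

theorem superCommutator_skew {i j : ZMod 2} {x y : A} (hx : x ∈ 𝒜 i) (hy : y ∈ 𝒜 j) :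
    superCommutator 𝒜 x y + koszulSign k i j • superCommutator 𝒜 y x = 0 := by
  rw [superCommutator_of_mem 𝒜 hx hy, superCommutator_of_mem 𝒜 hy hx]
  rcases zmod_two_cases i with rfl | rfl <;> rcases zmod_two_cases j with rfl | rfl <;>
    simp [koszulSign, ZMod.val_one]

theorem superCommutator_jacobi {i j l : ZMod 2} {x y z : A}
    (hx : x ∈ 𝒜 i) (hy : y ∈ 𝒜 j) (hz : z ∈ 𝒜 l) :
    koszulSign k i l • superCommutator 𝒜 x (superCommutator 𝒜 y z) +
      koszulSign k j i • superCommutator 𝒜 y (superCommutator 𝒜 z x) +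
      koszulSign k l j • superCommutator 𝒜 z (superCommutator 𝒜 x y) = 0 := by
  rw [superCommutator_of_mem 𝒜 hx (superCommutator_mem 𝒜 hy hz),
    superCommutator_of_mem 𝒜 hy (superCommutator_mem 𝒜 hz hx),
    superCommutator_of_mem 𝒜 hz (superCommutator_mem 𝒜 hx hy),
    superCommutator_of_mem 𝒜 hx hy, superCommutator_of_mem 𝒜 hy hz,
    superCommutator_of_mem 𝒜 hz hx]
  have h11 : (1 + 1 : ZMod 2) = 0 := by decide
  rcases zmod_two_cases i with rfl | rfl <;> rcases zmod_two_cases j with rfl | rfl <;>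
    rcases zmod_two_cases l with rfl | rfl <;>
    simp [koszulSign, ZMod.val_one, h11] <;> noncomm_ring

theorem superCommutator_cube {x : A} (hx : x ∈ 𝒜 1) :
    superCommutator 𝒜 x (superCommutator 𝒜 x x) = 0 := by
  have h11 : (1 + 1 : ZMod 2) = 0 := by decide
  rw [superCommutator_of_mem 𝒜 hx (superCommutator_mem 𝒜 hx hx),
    superCommutator_of_mem 𝒜 hx hx]
  simp [koszulSign, ZMod.val_one, h11]
  noncomm_ring

/-- `[ab, c]` summed cyclically with signs vanishes. -/
theorem superCommutator_cyclic {i j l : ZMod 2} {a b c : A}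
    (ha : a ∈ 𝒜 i) (hb : b ∈ 𝒜 j) (hc : c ∈ 𝒜 l) :
    koszulSign k i l • superCommutator 𝒜 (a * b) c +
      koszulSign k j i • superCommutator 𝒜 (b * c) a +
      koszulSign k l j • superCommutator 𝒜 (c * a) b = 0 := by
  rw [superCommutator_of_mem 𝒜 (SetLike.mul_mem_graded ha hb) hc,
    superCommutator_of_mem 𝒜 (SetLike.mul_mem_graded hb hc) ha,
    superCommutator_of_mem 𝒜 (SetLike.mul_mem_graded hc ha) hb]
  have h11 : (1 + 1 : ZMod 2) = 0 := by decide
  rcases zmod_two_cases i with rfl | rfl <;> rcases zmod_two_cases j with rfl | rfl <;>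
    rcases zmod_two_cases l with rfl | rfl <;>
    simp [koszulSign, ZMod.val_one, h11] <;> noncomm_ring

theorem parityMap_mul (x y : A) :
    parityMap 𝒜 (x * y) = parityMap 𝒜 x * parityMap 𝒜 y := by
  have h11 : (1 + 1 : ZMod 2) = 0 := by decide
  have key : ∀ i j : ZMod 2, ∀ x ∈ 𝒜 i, ∀ y ∈ 𝒜 j,
      parityMap 𝒜 (x * y) = parityMap 𝒜 x * parityMap 𝒜 y := by
    intro i j x hx y hy
    have hxy := SetLike.mul_mem_graded hx hy
    rcases zmod_two_cases i with rfl | rfl <;> rcases zmod_two_cases j with rfl | rfl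
    · rw [parityMap_of_mem_zero 𝒜 hx, parityMap_of_mem_zero 𝒜 hy,
        parityMap_of_mem_zero 𝒜 (by simpa using hxy)]
    · rw [parityMap_of_mem_zero 𝒜 hx, parityMap_of_mem_one 𝒜 hy,
        parityMap_of_mem_one 𝒜 (by simpa using hxy), mul_neg]
    · rw [parityMap_of_mem_one 𝒜 hx, parityMap_of_mem_zero 𝒜 hy,
        parityMap_of_mem_one 𝒜 (by simpa using hxy), neg_mul]
    · rw [parityMap_of_mem_one 𝒜 hx, parityMap_of_mem_one 𝒜 hy,
        parityMap_of_mem_zero 𝒜 (by simpa [h11] using hxy), neg_mul_neg]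
  rw [← proj_add_proj 𝒜 x, ← proj_add_proj 𝒜 y]
  simp only [add_mul, mul_add, map_add,
    key _ _ _ (proj_mem 𝒜 _ x) _ (proj_mem 𝒜 _ y)]

theorem parityMap_parityMap (x : A) : parityMap 𝒜 (parityMap 𝒜 x) = x := by
  conv_rhs => rw [← proj_add_proj 𝒜 x]
  conv_lhs => rw [← proj_add_proj 𝒜 x]
  rw [map_add, parityMap_of_mem_zero 𝒜 (proj_mem 𝒜 0 x),
    parityMap_of_mem_one 𝒜 (proj_mem 𝒜 1 x), map_add, map_neg,
    parityMap_of_mem_zero 𝒜 (proj_mem 𝒜 0 x), parityMap_of_mem_one 𝒜 (proj_mem 𝒜 1 x), neg_neg]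

theorem proj_parityMap (i : ZMod 2) (x : A) :
    GradedAlgebra.proj 𝒜 i (parityMap 𝒜 x) = parityMap 𝒜 (GradedAlgebra.proj 𝒜 i x) := by
  simp only [parityMap, LinearMap.sub_apply, map_sub, proj_of_mem 𝒜 (proj_mem 𝒜 _ x)]
  rcases zmod_two_cases i with rfl | rfl <;> simp [-GradedAlgebra.proj_apply]

end Associative

/-! ## Lie superalgebras -/

/-- A Lie superalgebra over `k` (with `2` invertible) on the `k`-module `L`. The last axiom follows
from the Jacobi identity when `3` is invertible and is part of the definition otherwise. -/
structure LieSuperalgebra (k L : Type*) [CommRing k] [AddCommGroup L] [Module k L] where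
  grading : ZMod 2 → Submodule k L
  isCompl : IsCompl (grading 0) (grading 1)
  bracket : L →ₗ[k] L →ₗ[k] L
  bracket_mem : ∀ {i j : ZMod 2} {x y : L}, x ∈ grading i → y ∈ grading j →
    bracket x y ∈ grading (i + j)
  skew : ∀ {i j : ZMod 2} {x y : L}, x ∈ grading i → y ∈ grading j →
    bracket x y + koszulSign k i j • bracket y x = 0
  jacobi : ∀ {i j l : ZMod 2} {x y z : L}, x ∈ grading i → y ∈ grading j → z ∈ grading l →
    koszulSign k i l • bracket x (bracket y z) + koszulSign k j i • bracket y (bracket z x) +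
      koszulSign k l j • bracket z (bracket x y) = 0
  odd_cube : ∀ {x : L}, x ∈ grading 1 → bracket x (bracket x x) = 0

/-- An associative superalgebra as a Lie superalgebra under the supercommutator. -/
def LieSuperalgebra.ofAssociative {k A : Type*} [CommRing k] [Ring A] [Algebra k A]
    (𝒜 : ZMod 2 → Submodule k A) [GradedAlgebra 𝒜] : LieSuperalgebra k A where
  grading := 𝒜
  isCompl := (DirectSum.isInternal_submodule_iff_isCompl 𝒜 zero_ne_one
    (by ext i; simpa using zmod_two_cases i)).1 (DirectSum.Decomposition.isInternal 𝒜)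
  bracket := superCommutator 𝒜
  bracket_mem := superCommutator_mem 𝒜
  skew := superCommutator_skew 𝒜
  jacobi := superCommutator_jacobi 𝒜
  odd_cube := superCommutator_cube 𝒜

namespace LieSuperalgebra

variable {k L : Type*} [CommRing k] [AddCommGroup L] [Module k L] (g : LieSuperalgebra k L)

/-- A submodule is a sub-superalgebra if it is spanned by homogeneous elements
and closed under the bracket. -/
structure IsSub (S : Submodule k L) : Prop where
  homogeneous : S ≤ (S ⊓ g.grading 0) ⊔ (S ⊓ g.grading 1)
  bracket_mem : ∀ x ∈ S, ∀ y ∈ S, g.bracket x y ∈ S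

/-- The Lie superalgebra structure on a sub-superalgebra. -/
def restrict {S : Submodule k L} (hS : g.IsSub S) : LieSuperalgebra k S where
  grading i := (g.grading i).comap S.subtype
  isCompl := by
    constructor
    · rw [Submodule.disjoint_def]
      intro x h0 h1
      exact Subtype.ext (Submodule.disjoint_def.1 g.isCompl.disjoint x.1 h0 h1)
    · rw [codisjoint_iff, eq_top_iff]
      rintro ⟨x, hx⟩ -
      obtain ⟨y, hy, z, hz, rfl⟩ := Submodule.mem_sup.1 (hS.homogeneous hx)
      exact Submodule.mem_sup.2 ⟨⟨y, hy.1⟩, hy.2, ⟨z, hz.1⟩, hz.2, rfl⟩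
  bracket := LinearMap.mk₂ k (fun x y => ⟨g.bracket x y, hS.bracket_mem x x.2 y y.2⟩)
    (fun _ _ _ => Subtype.ext (by simp)) (fun _ _ _ => Subtype.ext (by simp))
    (fun _ _ _ => Subtype.ext (by simp)) (fun _ _ _ => Subtype.ext (by simp))
  bracket_mem hx hy := g.bracket_mem hx hy
  skew hx hy := Subtype.ext (g.skew hx hy)
  jacobi hx hy hz := Subtype.ext (g.jacobi hx hy hz)
  odd_cube hx := Subtype.ext (g.odd_cube hx)

/-- `[S, S]`: the span of all brackets of elements of `S`. -/
def derivedSub (S : Submodule k L) : Submodule k L :=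
  Submodule.span k {z | ∃ x ∈ S, ∃ y ∈ S, z = g.bracket x y}

theorem isSub_derivedSub {S : Submodule k L} (hS : g.IsSub S) : g.IsSub (g.derivedSub S) := by
  have hle : g.derivedSub S ≤ S := by
    refine Submodule.span_le.2 ?_
    rintro _ ⟨x, hx, y, hy, rfl⟩
    exact hS.bracket_mem x hx y hy
  refine ⟨Submodule.span_le.2 ?_, fun x hx y hy =>
    Submodule.subset_span ⟨x, hle hx, y, hle hy, rfl⟩⟩
  rintro _ ⟨x, hx, y, hy, rfl⟩
  have key : ∀ i j : ZMod 2, ∀ x ∈ S ⊓ g.grading i, ∀ y ∈ S ⊓ g.grading j,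
      g.bracket x y ∈ (g.derivedSub S ⊓ g.grading 0) ⊔ (g.derivedSub S ⊓ g.grading 1) := by
    intro i j x hx y hy
    have hm : g.bracket x y ∈ g.derivedSub S ⊓ g.grading (i + j) :=
      ⟨Submodule.subset_span ⟨x, hx.1, y, hy.1, rfl⟩, g.bracket_mem hx.2 hy.2⟩
    rcases zmod_two_cases (i + j) with h | h <;> rw [h] at hm
    · exact Submodule.mem_sup_left hm
    · exact Submodule.mem_sup_right hm
  obtain ⟨x0, hx0, x1, hx1, rfl⟩ := Submodule.mem_sup.1 (hS.homogeneous hx)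
  obtain ⟨y0, hy0, y1, hy1, rfl⟩ := Submodule.mem_sup.1 (hS.homogeneous hy)
  simp only [map_add, LinearMap.add_apply]
  exact add_mem (add_mem (key _ _ _ hx0 _ hy0) (key _ _ _ hx1 _ hy0))
    (add_mem (key _ _ _ hx0 _ hy1) (key _ _ _ hx1 _ hy1))

/-! ### Second homology with trivial coefficients -/

/-- The relations `x ⊗ y + (-1)^{|x||y|} y ⊗ x`. -/
def skewRelations : Submodule k (L ⊗[k] L) :=
  Submodule.span k {t | ∃ i j : ZMod 2, ∃ x ∈ g.grading i, ∃ y ∈ g.grading j,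
    t = x ⊗ₜ[k] y + koszulSign k i j • (y ⊗ₜ[k] x)}

/-- The super exterior square of `L`. -/
abbrev Wedge2 : Type _ := (L ⊗[k] L) ⧸ g.skewRelations

/-- `x ∧ y` in the super exterior square. -/
def wedge (x y : L) : g.Wedge2 := g.skewRelations.mkQ (x ⊗ₜ[k] y)

theorem skewRelations_le : g.skewRelations ≤ LinearMap.ker (TensorProduct.lift g.bracket) := by
  refine Submodule.span_le.2 ?_
  rintro _ ⟨i, j, x, hx, y, hy, rfl⟩
  simpa using g.skew hx hy

/-- The differential `x ∧ y ↦ [x, y]`. -/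
def d2 : g.Wedge2 →ₗ[k] L :=
  g.skewRelations.liftQ (TensorProduct.lift g.bracket) g.skewRelations_le

/-- The 2-boundaries: the image of the differential
`x ∧ y ∧ z ↦ ± ((-1)^{|x||z|} [x,y] ∧ z + (-1)^{|y||x|} [y,z] ∧ x + (-1)^{|z||y|} [z,x] ∧ y)`,
together with the images `[x, x] ∧ x`, up to a unit, of the divided cubes of odd elements `x`
(these are redundant when `3` is invertible). -/
def boundaries : Submodule k g.Wedge2 :=
  Submodule.span k
    ({t | ∃ i j l : ZMod 2, ∃ x ∈ g.grading i, ∃ y ∈ g.grading j, ∃ z ∈ g.grading l,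
      t = koszulSign k i l • g.wedge (g.bracket x y) z +
        koszulSign k j i • g.wedge (g.bracket y z) x +
        koszulSign k l j • g.wedge (g.bracket z x) y} ∪
    {t | ∃ x ∈ g.grading 1, t = g.wedge (g.bracket x x) x})

/-- The 2-cycles. -/
abbrev cycles : Submodule k g.Wedge2 := LinearMap.ker g.d2

/-- `H₂(L)`, the cycles modulo the boundaries. -/
abbrev H2 : Type _ := g.cycles ⧸ g.boundaries.submoduleOf g.cycles

/-- The induced `ZMod 2`-grading of `H₂(L)`: classes of homogeneous cycles. -/
def H2Grading (i : ZMod 2) : Submodule k g.H2 :=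
  ((((superTensorGrading g.grading g.grading i).map g.skewRelations.mkQ).submoduleOf
    g.cycles).map (g.boundaries.submoduleOf g.cycles).mkQ)

/-- Boundaries are cycles. -/
theorem boundaries_le_cycles : g.boundaries ≤ g.cycles := by
  have hw : ∀ x y, g.d2 (g.wedge x y) = g.bracket x y := fun x y => by
    rw [d2, wedge, Submodule.mkQ_apply, Submodule.liftQ_apply, TensorProduct.lift.tmul]
  have flip : ∀ {i j : ZMod 2} {x y : L}, x ∈ g.grading i → y ∈ g.grading j →
      g.bracket x y = -(koszulSign k i j • g.bracket y x) := fun hx hy =>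
    eq_neg_of_add_eq_zero_left (g.skew hx hy)
  have h11 : (1 + 1 : ZMod 2) = 0 := by decide
  refine Submodule.span_le.2 ?_
  rintro _ (⟨i, j, l, x, hx, y, hy, z, hz, rfl⟩ | ⟨x, hx, rfl⟩)
  · simp only [SetLike.mem_coe, LinearMap.mem_ker, map_add, map_smul, hw]
    rw [flip (g.bracket_mem hx hy) hz, flip (g.bracket_mem hy hz) hx,
      flip (g.bracket_mem hz hx) hy]
    rw [← neg_eq_zero, ← g.jacobi hx hy hz]
    rcases zmod_two_cases i with rfl | rfl <;> rcases zmod_two_cases j with rfl | rfl <;>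
      rcases zmod_two_cases l with rfl | rfl <;>
      simp [koszulSign, ZMod.val_one, h11] <;> abel
  · simp only [SetLike.mem_coe, LinearMap.mem_ker, hw]
    rw [flip (g.bracket_mem hx hx) hx, g.odd_cube hx, smul_zero, neg_zero]

end LieSuperalgebra

/-! ## First cyclic homology -/

section Cyclic

variable {k R : Type*} [CommRing k] [Ring R] [Algebra k R]
  (𝓡 : ZMod 2 → Submodule k R) [GradedAlgebra 𝓡]

/-- The submodule `I_R` of `R ⊗ R` of skew-symmetry and cyclicity relations. -/
def cyclicRelations : Submodule k (R ⊗[k] R) :=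
  Submodule.span k
    ({t | ∃ i j : ZMod 2, ∃ a ∈ 𝓡 i, ∃ b ∈ 𝓡 j,
      t = a ⊗ₜ[k] b + koszulSign k i j • (b ⊗ₜ[k] a)} ∪
    {t | ∃ i j l : ZMod 2, ∃ a ∈ 𝓡 i, ∃ b ∈ 𝓡 j, ∃ c ∈ 𝓡 l,
      t = koszulSign k i l • ((a * b) ⊗ₜ[k] c) + koszulSign k j i • ((b * c) ⊗ₜ[k] a) +
        koszulSign k l j • ((c * a) ⊗ₜ[k] b)})

theorem cyclicRelations_le :
    cyclicRelations 𝓡 ≤ LinearMap.ker (TensorProduct.lift (superCommutator 𝓡)) := by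
  refine Submodule.span_le.2 ?_
  rintro _ (⟨i, j, a, ha, b, hb, rfl⟩ | ⟨i, j, l, a, ha, b, hb, c, hc, rfl⟩)
  · simpa using superCommutator_skew 𝓡 ha hb
  · simpa using superCommutator_cyclic 𝓡 ha hb hc

/-- The map `⟨R, R⟩ = (R ⊗ R) / I_R → R` induced by the supercommutator. -/
def cyclicCommutator : ((R ⊗[k] R) ⧸ cyclicRelations 𝓡) →ₗ[k] R :=
  (cyclicRelations 𝓡).liftQ (TensorProduct.lift (superCommutator 𝓡)) (cyclicRelations_le 𝓡)

/-- `HC₁(R)`: the classes of `∑ aᵢ ⊗ bᵢ` in `⟨R, R⟩` with `∑ [aᵢ, bᵢ] = 0`. -/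
abbrev HC1 : Submodule k ((R ⊗[k] R) ⧸ cyclicRelations 𝓡) :=
  LinearMap.ker (cyclicCommutator 𝓡)

/-- The induced `ZMod 2`-grading of `HC₁(R)`. -/
def HC1Grading (i : ZMod 2) : Submodule k (HC1 𝓡) :=
  ((superTensorGrading 𝓡 𝓡 i).map (cyclicRelations 𝓡).mkQ).submoduleOf (HC1 𝓡)

end Cyclic

/-! ## The queer Lie superalgebras -/

section Queer

variable {k R : Type*} [CommRing k] [Ring R] [Algebra k R]
  (𝓡 : ZMod 2 → Submodule k R) [GradedAlgebra 𝓡]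

/-- The parity of the indices of `M_{m|n}`: even on the first block, odd on the second. -/
def blockParity {m n : ℕ} : Fin m ⊕ Fin n → ZMod 2 := Sum.elim (fun _ => 0) (fun _ => 1)

/-- The grading of `M_{m|n}(R)` in which `e_{ij}(a)` has parity `|i| + |j| + |a|`. -/
def matrixGrading (m n : ℕ) (p : ZMod 2) :
    Submodule k (Matrix (Fin m ⊕ Fin n) (Fin m ⊕ Fin n) R) where
  carrier := {X | ∀ i j, X i j ∈ 𝓡 (p + (blockParity i + blockParity j))}
  add_mem' hX hY i j := add_mem (hX i j) (hY i j)
  zero_mem' _ _ := zero_mem _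
  smul_mem' c _ hX i j := Submodule.smul_mem _ c (hX i j)

/-- The component of parity `p` of a matrix. -/
def matrixComponent (m n : ℕ) (p : ZMod 2) :
    Matrix (Fin m ⊕ Fin n) (Fin m ⊕ Fin n) R →ₗ[k] matrixGrading 𝓡 m n p where
  toFun X := ⟨Matrix.of fun i j =>
    GradedAlgebra.proj 𝓡 (p + (blockParity i + blockParity j)) (X i j),
    fun i j => proj_mem 𝓡 _ (X i j)⟩
  map_add' X Y := by ext i j; simp [-GradedAlgebra.proj_apply]
  map_smul' c X := by ext i j; simp [-GradedAlgebra.proj_apply]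

instance matrixGradedAlgebra (m n : ℕ) : GradedAlgebra (matrixGrading 𝓡 m n) where
  one_mem i j := by
    by_cases h : i = j
    · subst h
      have : ∀ a : ZMod 2, 0 + (a + a) = 0 := by decide
      rw [Matrix.one_apply_eq, this]
      exact SetLike.one_mem_graded 𝓡
    · rw [Matrix.one_apply_ne h]
      exact zero_mem _
  mul_mem {p q} X Y hX hY i j := by
    rw [Matrix.mul_apply]
    refine sum_mem fun l _ => ?_
    have : ∀ p q a b c : ZMod 2, (p + (a + b)) + (q + (b + c)) = p + q + (a + c) := by decide
    exact this p q _ _ _ ▸ SetLike.mul_mem_graded (hX i l) (hY l j)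
  toDecomposition := DirectSum.Decomposition.ofLinearMap (matrixGrading 𝓡 m n)
    (∑ p : ZMod 2, DirectSum.lof k (ZMod 2) (fun p => matrixGrading 𝓡 m n p) p ∘ₗ
      matrixComponent 𝓡 m n p)
    (by
      refine LinearMap.ext fun X => Matrix.ext fun i j => ?_
      have h : ∀ a : ZMod 2, (0 + a = 0 ∧ 1 + a = 1) ∨ (0 + a = 1 ∧ 1 + a = 0) := by decide
      simp only [LinearMap.comp_apply, LinearMap.sum_apply, map_sum, DirectSum.coeLinearMap_lof,
        LinearMap.id_apply, Matrix.sum_apply]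
      refine (Fin.sum_univ_two _).trans (Eq.trans ?_ (proj_add_proj 𝓡 (X i j)))
      change GradedAlgebra.proj 𝓡 (0 + (blockParity i + blockParity j)) (X i j) +
        GradedAlgebra.proj 𝓡 (1 + (blockParity i + blockParity j)) (X i j) = _
      rcases h (blockParity i + blockParity j) with ⟨h0, h1⟩ | ⟨h0, h1⟩ <;> rw [h0, h1]
      exact add_comm _ _)
    (by
      refine DirectSum.linearMap_ext k fun p => LinearMap.ext fun X => ?_
      simp only [LinearMap.comp_apply, LinearMap.sum_apply, DirectSum.coeLinearMap_lof,
        LinearMap.id_apply]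
      rw [Finset.sum_eq_single p]
      · congr 1
        refine Subtype.ext (Matrix.ext fun i j => ?_)
        change GradedAlgebra.proj 𝓡 _ (X.1 i j) = X.1 i j
        rw [proj_of_mem 𝓡 (X.2 i j), if_pos rfl]
      · intro q _ hq
        have : matrixComponent 𝓡 m n q X.1 = 0 := by
          refine Subtype.ext (Matrix.ext fun i j => ?_)
          change GradedAlgebra.proj 𝓡 _ (X.1 i j) = 0
          rw [proj_of_mem 𝓡 (X.2 i j), if_neg fun h => hq (add_right_cancel h)]
        rw [this, map_zero]
      · exact fun h => absurd (Finset.mem_univ p) h)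

theorem matrix_proj_apply {m n : ℕ} (p : ZMod 2) (X : Matrix (Fin m ⊕ Fin n) (Fin m ⊕ Fin n) R)
    (i j) : GradedAlgebra.proj (matrixGrading 𝓡 m n) p X i j =
      GradedAlgebra.proj 𝓡 (p + (blockParity i + blockParity j)) (X i j) := by
  have h : ∀ q, GradedAlgebra.proj (matrixGrading 𝓡 m n) p (matrixComponent 𝓡 m n q X).1 =
      if p = q then (matrixComponent 𝓡 m n q X).1 else 0 := fun q =>
    proj_of_mem _ (matrixComponent 𝓡 m n q X).2 p
  have hX : X = (matrixComponent 𝓡 m n 0 X).1 + (matrixComponent 𝓡 m n 1 X).1 := by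
    refine Matrix.ext fun i j => ?_
    have h : ∀ a : ZMod 2, (0 + a = 0 ∧ 1 + a = 1) ∨ (0 + a = 1 ∧ 1 + a = 0) := by decide
    change _ = GradedAlgebra.proj 𝓡 (0 + (blockParity i + blockParity j)) (X i j) +
        GradedAlgebra.proj 𝓡 (1 + (blockParity i + blockParity j)) (X i j)
    rcases h (blockParity i + blockParity j) with ⟨h0, h1⟩ | ⟨h0, h1⟩ <;> rw [h0, h1]
    · rw [proj_add_proj]
    · rw [add_comm, proj_add_proj]
  conv_lhs => rw [hX, map_add, h, h]
  rcases zmod_two_cases p with rfl | rfl <;>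
    simp [matrixComponent, -GradedAlgebra.proj_apply]

/-- The underlying module of `𝔮ₙ(R)`: block matrices `(A, B; ρ(B), ρ(A))`. -/
def queerSub (n : ℕ) : Submodule k (Matrix (Fin n ⊕ Fin n) (Fin n ⊕ Fin n) R) where
  carrier := {X | ∃ A B : Matrix (Fin n) (Fin n) R,
    X = Matrix.fromBlocks A B (B.map (parityMap 𝓡)) (A.map (parityMap 𝓡))}
  add_mem' := by
    rintro _ _ ⟨A, B, rfl⟩ ⟨A', B', rfl⟩
    refine ⟨A + A', B + B', ?_⟩
    rw [Matrix.fromBlocks_add]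
    congr 1 <;> ext <;> simp
  zero_mem' := ⟨0, 0, by ext (i | i) (j | j) <;> simp⟩
  smul_mem' := by
    rintro c _ ⟨A, B, rfl⟩
    refine ⟨c • A, c • B, ?_⟩
    rw [Matrix.fromBlocks_smul]
    congr 1 <;> ext <;> simp

theorem queerSub_mul {n : ℕ} {X Y : Matrix (Fin n ⊕ Fin n) (Fin n ⊕ Fin n) R}
    (hX : X ∈ queerSub 𝓡 n) (hY : Y ∈ queerSub 𝓡 n) : X * Y ∈ queerSub 𝓡 n := by
  obtain ⟨A, B, rfl⟩ := hX
  obtain ⟨C, D, rfl⟩ := hY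
  refine ⟨A * C + B * D.map (parityMap 𝓡), A * D + B * C.map (parityMap 𝓡), ?_⟩
  rw [Matrix.fromBlocks_multiply]
  congr 1 <;> ext i j <;>
    simp [Matrix.mul_apply, parityMap_mul, parityMap_parityMap, add_comm]

theorem queerSub_proj {n : ℕ} (p : ZMod 2) {X : Matrix (Fin n ⊕ Fin n) (Fin n ⊕ Fin n) R}
    (hX : X ∈ queerSub 𝓡 n) : GradedAlgebra.proj (matrixGrading 𝓡 n n) p X ∈ queerSub 𝓡 n := by
  obtain ⟨A, B, rfl⟩ := hX
  refine ⟨A.map (GradedAlgebra.proj 𝓡 p), B.map (GradedAlgebra.proj 𝓡 (p + 1)), ?_⟩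
  have h : ∀ (Y : Matrix (Fin n ⊕ Fin n) (Fin n ⊕ Fin n) R) (i j),
      GradedAlgebra.proj (matrixGrading 𝓡 n n) p Y i j =
        GradedAlgebra.proj 𝓡 (p + (blockParity i + blockParity j)) (Y i j) := by
    intro Y i j
    rw [matrix_proj_apply]
  have h11 : (1 + 1 : ZMod 2) = 0 := by decide
  ext (i | i) (j | j) <;> rw [h] <;>
    simp [blockParity, h11, -GradedAlgebra.proj_apply, proj_parityMap]

theorem isSub_queerSub (n : ℕ) :
    (LieSuperalgebra.ofAssociative (matrixGrading 𝓡 n n)).IsSub (queerSub 𝓡 n) where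
  homogeneous X hX := by
    rw [← proj_add_proj (matrixGrading 𝓡 n n) X]
    exact Submodule.add_mem_sup ⟨queerSub_proj 𝓡 0 hX, proj_mem (matrixGrading 𝓡 n n) 0 X⟩
      ⟨queerSub_proj 𝓡 1 hX, proj_mem (matrixGrading 𝓡 n n) 1 X⟩
  bracket_mem X hX Y hY := by
    change superCommutator (matrixGrading 𝓡 n n) X Y ∈ _
    simp only [superCommutator, LinearMap.sub_apply, LinearMap.mul_apply', LinearMap.sum_apply,
      LinearMap.smul_apply, LinearMap.compl₁₂_apply, LinearMap.flip_apply]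
    exact sub_mem (queerSub_mul 𝓡 hX hY) (sum_mem fun i _ => sum_mem fun j _ =>
      Submodule.smul_mem _ _ (queerSub_mul 𝓡 (queerSub_proj 𝓡 j hY) (queerSub_proj 𝓡 i hX)))

/-- The underlying module of `𝔰𝔮ₙ(R) = [𝔮ₙ(R), 𝔮ₙ(R)]`. -/
def specialQueerSub (n : ℕ) : Submodule k (Matrix (Fin n ⊕ Fin n) (Fin n ⊕ Fin n) R) :=
  (LieSuperalgebra.ofAssociative (matrixGrading 𝓡 n n)).derivedSub (queerSub 𝓡 n)

/-- The special queer Lie superalgebra `𝔰𝔮ₙ(R)`. -/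
def specialQueer (n : ℕ) : LieSuperalgebra k (specialQueerSub 𝓡 n) :=
  (LieSuperalgebra.ofAssociative (matrixGrading 𝓡 n n)).restrict
    (LieSuperalgebra.isSub_derivedSub _ (isSub_queerSub 𝓡 n))

end Queer

end

noncomputable section

set_option linter.unusedSectionVars false

/-! ### Koszul signs. -/

section Signs

variable (k : Type*) [CommRing k]

/-! Let `S = R ⊕ R ν` with `ν` odd, `ν² = 1` and `ν a = ρ(a) ν` (`QueerDouble`). Reading the block
matrix `(A, B; ρ(B), ρ(A))` as `A + B ν` turns `𝔮ₙ(R)` into the `n × n` matrices over `S` with all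
indices even, and `𝔰𝔮ₙ(R)` into those with trace in `[S, S]`. The proof computes `H₂` of the latter
as `HC₁(S)`, then identifies `HC₁(S)` with `HC₁(R)` with reversed parity.

For the matrix algebra, `x ∧ y ↦ ∑ ⟨x p q, y q p⟩` kills boundaries: the Jacobi relation follows
from cyclicity, and `[x, x] ∧ x` dies because the trace lies in `[S, S]` (`tracePair_cube`). It
sends cycles into `HC₁(S)`. Injectivity on cycles comes from `retraction_apply`: modulo boundaries,
every class is recovered from its differential and its pairing. The main device is that `E_pp(1)`
lies in the algebra, since `[ν, ν] = 2` and `2` is invertible. Bracketing with it gives weights that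
express most wedges of matrix units through their brackets (`wedgeClass_idem_bracket`). Only the
classes `E_pq(a) ∧ E_qp(b)` remain. The derivation rule and a third index reduce them to one skew
and cyclic expression in `a`, `b`, plus terms fixed by the differential (`cartanClass_eq`,
`diagClass_cyclic`). Conversely, `E_pq(a) ⊗ E_qp(b) - E_pq(ab) ⊗ E_qp(1)` lifts `a ⊗ b`.

For the passage from `S` to `R`, the `ν`-part `oddPart` of the pairing has the section `⟨a, b⟩ ↦ ⟨a,
b ν⟩`. Twice the complementary part of `u` is `⟨c ν, ν⟩`, with `c` the `R`-component of the
commutator of `u` (`two_smul_eq`). It vanishes on `HC₁(S)`. Since `ν` is odd, this identification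
exchanges parities. -/

theorem koszulSign_zero_left (j : ZMod 2) : koszulSign k 0 j = 1 := by simp [koszulSign]

theorem koszulSign_zero_right (i : ZMod 2) : koszulSign k i 0 = 1 := by simp [koszulSign]

theorem koszulSign_one_one : koszulSign k 1 1 = -1 := by simp [koszulSign, ZMod.val_one]

theorem zmod_two_one_add_one : (1 + 1 : ZMod 2) = 0 := by decide

end Signs

/-! ### Reduction to homogeneous elements and the parity map. -/

section Homogeneous

variable {k A M : Type*} [CommRing k] [Ring A] [Algebra k A] [AddCommGroup M] [Module k M]
  (𝒜 : ZMod 2 → Submodule k A) [GradedAlgebra 𝒜]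

theorem linearMap_ext_homogeneous {f g : A →ₗ[k] M} (h : ∀ i, ∀ a ∈ 𝒜 i, f a = g a) : f = g := by
  ext a
  rw [← proj_add_proj 𝒜 a, map_add, map_add, h _ _ (proj_mem 𝒜 0 a), h _ _ (proj_mem 𝒜 1 a)]

theorem bilinear_ext_homogeneous {f g : A →ₗ[k] A →ₗ[k] M}
    (h : ∀ i j, ∀ a ∈ 𝒜 i, ∀ b ∈ 𝒜 j, f a b = g a b) : f = g :=
  linearMap_ext_homogeneous 𝒜 fun i a ha => linearMap_ext_homogeneous 𝒜 fun j b hb => h i j a ha b hb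

theorem parityMap_mem {i : ZMod 2} {x : A} (hx : x ∈ 𝒜 i) : parityMap 𝒜 x ∈ 𝒜 i := by
  rcases zmod_two_cases i with rfl | rfl
  · rwa [parityMap_of_mem_zero 𝒜 hx]
  · rw [parityMap_of_mem_one 𝒜 hx]
    exact neg_mem hx

theorem parityMap_of_mem {i : ZMod 2} {x : A} (hx : x ∈ 𝒜 i) :
    parityMap 𝒜 x = koszulSign k 1 i • x := by
  rcases zmod_two_cases i with rfl | rfl
  · rw [parityMap_of_mem_zero 𝒜 hx, koszulSign_zero_right, one_smul]
  · rw [parityMap_of_mem_one 𝒜 hx, koszulSign_one_one, neg_smul, one_smul]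

theorem parityMap_one : parityMap 𝒜 1 = 1 :=
  parityMap_of_mem_zero 𝒜 (SetLike.one_mem_graded 𝒜)

end Homogeneous

/-! ## The universal cyclic pairing -/

section Pairing

variable {k R M : Type*} [CommRing k] [Ring R] [Algebra k R] [AddCommGroup M] [Module k M]
  (𝓡 : ZMod 2 → Submodule k R) [GradedAlgebra 𝓡]

/-- The pairing `⟨a, b⟩`, the class of `a ⊗ b` in `(R ⊗ R) / I_R`. -/
def cyclicPair : R →ₗ[k] R →ₗ[k] ((R ⊗[k] R) ⧸ cyclicRelations 𝓡) :=
  (TensorProduct.mk k R R).compr₂ (cyclicRelations 𝓡).mkQ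

theorem mkQ_tmul (a b : R) : (cyclicRelations 𝓡).mkQ (a ⊗ₜ[k] b) = cyclicPair 𝓡 a b := rfl

theorem cyclicPair_skew {i j : ZMod 2} {a b : R} (ha : a ∈ 𝓡 i) (hb : b ∈ 𝓡 j) :
    cyclicPair 𝓡 a b + koszulSign k i j • cyclicPair 𝓡 b a = 0 := by
  simp only [← mkQ_tmul, ← map_smul, ← map_add]
  exact (Submodule.Quotient.mk_eq_zero _).2
    (Submodule.subset_span (Or.inl ⟨i, j, a, ha, b, hb, rfl⟩))

theorem cyclicPair_cyclic {i j l : ZMod 2} {a b c : R} (ha : a ∈ 𝓡 i) (hb : b ∈ 𝓡 j)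
    (hc : c ∈ 𝓡 l) :
    koszulSign k i l • cyclicPair 𝓡 (a * b) c + koszulSign k j i • cyclicPair 𝓡 (b * c) a +
      koszulSign k l j • cyclicPair 𝓡 (c * a) b = 0 := by
  simp only [← mkQ_tmul, ← map_smul, ← map_add]
  exact (Submodule.Quotient.mk_eq_zero _).2
    (Submodule.subset_span (Or.inr ⟨i, j, l, a, ha, b, hb, c, hc, rfl⟩))

theorem cyclicCommutator_cyclicPair (a b : R) :
    cyclicCommutator 𝓡 (cyclicPair 𝓡 a b) = superCommutator 𝓡 a b := by
  rw [← mkQ_tmul, cyclicCommutator, Submodule.mkQ_apply, Submodule.liftQ_apply,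
    TensorProduct.lift.tmul]

/-- Cyclicity of `(a, 1, 1)` gives `2⟨a, 1⟩ + ⟨1, a⟩ = 0`. Subtracting skew-symmetry leaves `⟨a, 1⟩
= 0`, with no division by `2`. -/
theorem cyclicPair_one_right (a : R) : cyclicPair 𝓡 a 1 = 0 := by
  suffices (cyclicPair 𝓡).flip 1 = 0 from LinearMap.congr_fun this a
  refine linearMap_ext_homogeneous 𝓡 fun i a ha => ?_
  have h1 := SetLike.one_mem_graded 𝓡
  have h := cyclicPair_cyclic 𝓡 ha h1 h1
  have h' := cyclicPair_skew 𝓡 ha h1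
  simp only [koszulSign_zero_left, koszulSign_zero_right, one_smul, mul_one, one_mul] at h h'
  rw [LinearMap.flip_apply, LinearMap.zero_apply]
  linear_combination (norm := module) h - h'

theorem cyclicPair_one_left (a : R) : cyclicPair 𝓡 1 a = 0 := by
  suffices cyclicPair 𝓡 1 = 0 from LinearMap.congr_fun this a
  refine linearMap_ext_homogeneous 𝓡 fun i a ha => ?_
  have h' := cyclicPair_skew 𝓡 (SetLike.one_mem_graded 𝓡) ha
  rw [cyclicPair_one_right, smul_zero, add_zero] at h'
  rw [h', LinearMap.zero_apply]

theorem cyclicQuotient_ext {f g : ((R ⊗[k] R) ⧸ cyclicRelations 𝓡) →ₗ[k] M}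
    (h : ∀ i j, ∀ a ∈ 𝓡 i, ∀ b ∈ 𝓡 j, f (cyclicPair 𝓡 a b) = g (cyclicPair 𝓡 a b)) : f = g := by
  have := bilinear_ext_homogeneous 𝓡 (f := (cyclicPair 𝓡).compr₂ f) (g := (cyclicPair 𝓡).compr₂ g) h
  refine Submodule.linearMap_qext _ (TensorProduct.ext' fun a b => ?_)
  exact LinearMap.congr_fun₂ this a b

/-- A bilinear map with the skew-symmetry and the cyclicity of `⟨a, b⟩` factors through it. -/
def cyclicLift (f : R →ₗ[k] R →ₗ[k] M)
    (hs : ∀ i j, ∀ a ∈ 𝓡 i, ∀ b ∈ 𝓡 j, f a b + koszulSign k i j • f b a = 0)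
    (hc : ∀ i j l, ∀ a ∈ 𝓡 i, ∀ b ∈ 𝓡 j, ∀ c ∈ 𝓡 l, koszulSign k i l • f (a * b) c +
      koszulSign k j i • f (b * c) a + koszulSign k l j • f (c * a) b = 0) :
    ((R ⊗[k] R) ⧸ cyclicRelations 𝓡) →ₗ[k] M :=
  (cyclicRelations 𝓡).liftQ (TensorProduct.lift f) <| by
    refine Submodule.span_le.2 ?_
    rintro _ (⟨i, j, a, ha, b, hb, rfl⟩ | ⟨i, j, l, a, ha, b, hb, c, hc', rfl⟩)
    · simpa using hs i j a ha b hb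
    · simpa using hc i j l a ha b hb c hc'

theorem cyclicLift_cyclicPair (f : R →ₗ[k] R →ₗ[k] M) (hs hc) (a b : R) :
    cyclicLift 𝓡 f hs hc (cyclicPair 𝓡 a b) = f a b :=
  (Submodule.liftQ_apply _ _ _).trans (TensorProduct.lift.tmul _ _)

/-- The `k`-module `[R, R]` spanned by supercommutators. -/
def commutatorSpan : Submodule k R :=
  Submodule.span k {t | ∃ i j, ∃ a ∈ 𝓡 i, ∃ b ∈ 𝓡 j, t = superCommutator 𝓡 a b}

/-- The obstruction to `⟨a², a⟩ = 0` for odd `a` is additive. -/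
theorem cyclicPair_cube_add {a b : R} (ha : a ∈ 𝓡 1) (hb : b ∈ 𝓡 1) :
    cyclicPair 𝓡 ((a + b) * (a + b)) (a + b) =
      cyclicPair 𝓡 (a * a) a + cyclicPair 𝓡 (b * b) b := by
  have h := cyclicPair_cyclic 𝓡 ha ha hb
  have h' := cyclicPair_cyclic 𝓡 hb hb ha
  simp only [koszulSign_one_one] at h h'
  simp only [add_mul, mul_add, map_add, LinearMap.add_apply]
  linear_combination (norm := module) -h - h'

/-- Cyclicity of `(a, b, abab)` and of `(b, a, baba)` expresses both sides through the same two
terms `⟨babab, a⟩` and `⟨ababa, b⟩`. -/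
theorem cyclicPair_cube_comm {a b : R} (ha : a ∈ 𝓡 0) (hb : b ∈ 𝓡 1) :
    cyclicPair 𝓡 (a * b * (a * b)) (a * b) = cyclicPair 𝓡 (b * a * (b * a)) (b * a) := by
  have hab : a * b ∈ 𝓡 1 := by simpa using SetLike.mul_mem_graded ha hb
  have hba : b * a ∈ 𝓡 1 := by simpa using SetLike.mul_mem_graded hb ha
  have h1 : a * b * (a * b) ∈ 𝓡 0 := by
    simpa [zmod_two_one_add_one] using SetLike.mul_mem_graded hab hab
  have h2 : b * a * (b * a) ∈ 𝓡 0 := by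
    simpa [zmod_two_one_add_one] using SetLike.mul_mem_graded hba hba
  have e1 := cyclicPair_cyclic 𝓡 ha hb h1
  have e2 := cyclicPair_cyclic 𝓡 hb ha h2
  have s1 := cyclicPair_skew 𝓡 h1 hab
  have s2 := cyclicPair_skew 𝓡 h2 hba
  simp only [koszulSign_zero_left, koszulSign_zero_right, one_smul, mul_assoc] at *
  linear_combination (norm := module) s1 - s2 - e1 + e2

/-- `⟨t², t⟩ = 0` for the odd part `t` of an element of `[R, R]`. -/
theorem cyclicPair_cube_of_mem_commutatorSpan {t : R} (ht : t ∈ commutatorSpan 𝓡) :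
    cyclicPair 𝓡 (GradedAlgebra.proj 𝓡 1 t * GradedAlgebra.proj 𝓡 1 t)
      (GradedAlgebra.proj 𝓡 1 t) = 0 := by
  induction ht using Submodule.span_induction with
  | mem t ht =>
    obtain ⟨i, j, a, ha, b, hb, rfl⟩ := ht
    -- Only factors of different parity give an odd commutator. It is then `±(ab - ba)`, and the
    -- additive cube takes equal values on `ab` and `ba`.
    have key : ∀ a ∈ 𝓡 0, ∀ b ∈ 𝓡 1, cyclicPair 𝓡 ((a * b + -(b * a)) * (a * b + -(b * a)))
        (a * b + -(b * a)) = 0 := by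
      intro a ha b hb
      rw [cyclicPair_cube_add 𝓡 (by simpa using SetLike.mul_mem_graded ha hb)
        (neg_mem (by simpa using SetLike.mul_mem_graded hb ha)), cyclicPair_cube_comm 𝓡 ha hb]
      simp
    rw [proj_of_mem 𝓡 (superCommutator_mem 𝓡 ha hb), superCommutator_of_mem 𝓡 ha hb]
    rcases zmod_two_cases i with rfl | rfl <;> rcases zmod_two_cases j with rfl | rfl
    · simp
    · simpa [koszulSign_zero_left, sub_eq_add_neg] using key a ha b hb
    · have := key b hb a ha
      rw [show b * a + -(a * b) = -(a * b - b * a) by abel, neg_mul_neg, map_neg,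
        neg_eq_zero] at this
      simpa only [koszulSign_zero_right, one_smul, add_zero, if_true] using this
    · simp [zmod_two_one_add_one]
  | zero => simp
  | add x y _ _ hx hy =>
    rw [map_add, cyclicPair_cube_add 𝓡 (proj_mem 𝓡 1 x) (proj_mem 𝓡 1 y), hx, hy, add_zero]
  | smul c x _ hx =>
    rw [map_smul, smul_mul_smul_comm, map_smul, map_smul, LinearMap.smul_apply, hx, smul_zero,
      smul_zero]

end Pairing

/-! ## The superalgebra `R ⊕ R ν` with `ν` odd, `ν² = 1` and `ν a = ρ(a) ν` -/

section Double

variable {k R : Type*} [CommRing k] [Ring R] [Algebra k R]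
  (𝓡 : ZMod 2 → Submodule k R) [GradedAlgebra 𝓡]

/-- The superalgebra `R ⊕ R ν` with `ν` odd, `ν² = 1` and `ν a = ρ(a) ν`; the pair `(a, b)` stands
for `a + b ν`. -/
def QueerDouble (_ : ZMod 2 → Submodule k R) : Type _ := R × R

namespace QueerDouble

instance : AddCommGroup (QueerDouble 𝓡) := inferInstanceAs (AddCommGroup (R × R))

instance : Module k (QueerDouble 𝓡) := inferInstanceAs (Module k (R × R))

/-- The coefficient `a` of `a + b ν`. -/
def fst : QueerDouble 𝓡 →ₗ[k] R := LinearMap.fst k R R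

/-- The coefficient `b` of `a + b ν`. -/
def snd : QueerDouble 𝓡 →ₗ[k] R := LinearMap.snd k R R

/-- The inclusion `a ↦ a`. -/
def inl : R →ₗ[k] QueerDouble 𝓡 := LinearMap.inl k R R

/-- The inclusion `b ↦ b ν`. -/
def inr : R →ₗ[k] QueerDouble 𝓡 := LinearMap.inr k R R

variable {𝓡} in
@[ext] theorem ext {x y : QueerDouble 𝓡} (h : fst 𝓡 x = fst 𝓡 y) (h' : snd 𝓡 x = snd 𝓡 y) :
    x = y := Prod.ext h h'

@[simp] theorem fst_inl (a : R) : fst 𝓡 (inl 𝓡 a) = a := rfl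
@[simp] theorem snd_inl (a : R) : snd 𝓡 (inl 𝓡 a) = 0 := rfl
@[simp] theorem fst_inr (a : R) : fst 𝓡 (inr 𝓡 a) = 0 := rfl
@[simp] theorem snd_inr (a : R) : snd 𝓡 (inr 𝓡 a) = a := rfl

theorem inl_add_inr (x : QueerDouble 𝓡) : inl 𝓡 (fst 𝓡 x) + inr 𝓡 (snd 𝓡 x) = x := by
  ext <;> simp

instance : Mul (QueerDouble 𝓡) where
  mul x y := inl 𝓡 (fst 𝓡 x * fst 𝓡 y + snd 𝓡 x * parityMap 𝓡 (snd 𝓡 y)) +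
    inr 𝓡 (fst 𝓡 x * snd 𝓡 y + snd 𝓡 x * parityMap 𝓡 (fst 𝓡 y))

instance : One (QueerDouble 𝓡) where
  one := inl 𝓡 1

theorem one_def : (1 : QueerDouble 𝓡) = inl 𝓡 1 := rfl

theorem fst_mul (x y : QueerDouble 𝓡) :
    fst 𝓡 (x * y) = fst 𝓡 x * fst 𝓡 y + snd 𝓡 x * parityMap 𝓡 (snd 𝓡 y) := add_zero _

theorem snd_mul (x y : QueerDouble 𝓡) :
    snd 𝓡 (x * y) = fst 𝓡 x * snd 𝓡 y + snd 𝓡 x * parityMap 𝓡 (fst 𝓡 y) := zero_add _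

instance : Ring (QueerDouble 𝓡) where
  __ := (inferInstance : AddCommGroup (QueerDouble 𝓡))
  __ := (inferInstance : Mul (QueerDouble 𝓡))
  __ := (inferInstance : One (QueerDouble 𝓡))
  left_distrib x y z := by ext <;> simp only [fst_mul, snd_mul, map_add, mul_add] <;> abel
  right_distrib x y z := by ext <;> simp only [fst_mul, snd_mul, map_add, add_mul] <;> abel
  zero_mul x := by ext <;> simp [fst_mul, snd_mul]
  mul_zero x := by ext <;> simp [fst_mul, snd_mul]
  mul_assoc x y z := by
    ext <;> simp only [fst_mul, snd_mul, map_add, add_mul, mul_add, parityMap_mul,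
      parityMap_parityMap, mul_assoc] <;> abel
  one_mul x := by ext <;> simp [fst_mul, snd_mul, one_def]
  mul_one x := by ext <;> simp [fst_mul, snd_mul, one_def, parityMap_one]

instance : Algebra k (QueerDouble 𝓡) := Algebra.ofModule
  (fun c x y => by ext <;> simp [fst_mul, snd_mul])
  (fun c x y => by ext <;> simp [fst_mul, snd_mul])

/-- The grading of `R ⊕ R ν` in which `ν` is odd. -/
def grading (i : ZMod 2) : Submodule k (QueerDouble 𝓡) :=
  (𝓡 i).comap (fst 𝓡) ⊓ (𝓡 (i + 1)).comap (snd 𝓡)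

theorem mem_grading {i : ZMod 2} {x : QueerDouble 𝓡} :
    x ∈ grading 𝓡 i ↔ fst 𝓡 x ∈ 𝓡 i ∧ snd 𝓡 x ∈ 𝓡 (i + 1) := Iff.rfl

theorem inl_mem {i : ZMod 2} {a : R} (ha : a ∈ 𝓡 i) : inl 𝓡 a ∈ grading 𝓡 i :=
  ⟨ha, (𝓡 (i + 1)).zero_mem⟩

theorem inr_mem {i : ZMod 2} {a : R} (ha : a ∈ 𝓡 i) : inr 𝓡 a ∈ grading 𝓡 (i + 1) :=
  ⟨(𝓡 (i + 1)).zero_mem, by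
    have : i + 1 + 1 = i := by clear ha; revert i; decide
    exact this.symm ▸ ha⟩

theorem isCompl_grading : IsCompl (grading 𝓡 0) (grading 𝓡 1) := by
  have h := (LieSuperalgebra.ofAssociative 𝓡).isCompl
  constructor
  · rw [Submodule.disjoint_def]
    intro x h0 h1
    ext
    · exact Submodule.disjoint_def.1 h.disjoint _ h0.1 h1.1
    · exact Submodule.disjoint_def.1 h.disjoint _ h1.2 h0.2
  · rw [codisjoint_iff, eq_top_iff]
    intro x _
    have h1 := Submodule.add_mem_sup (inl_mem 𝓡 (proj_mem 𝓡 0 (fst 𝓡 x)))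
      (inl_mem 𝓡 (proj_mem 𝓡 1 (fst 𝓡 x)))
    have h2 := Submodule.add_mem_sup (inr_mem 𝓡 (proj_mem 𝓡 1 (snd 𝓡 x)))
      (inr_mem 𝓡 (proj_mem 𝓡 0 (snd 𝓡 x)))
    rw [← map_add, proj_add_proj] at h1
    rw [← map_add, add_comm (GradedAlgebra.proj 𝓡 1 (snd 𝓡 x)), proj_add_proj, zmod_two_one_add_one, zero_add] at h2
    rw [← inl_add_inr 𝓡 x]
    exact add_mem h1 h2

instance : GradedAlgebra (grading 𝓡) where
  one_mem := inl_mem 𝓡 (SetLike.one_mem_graded 𝓡)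
  mul_mem i j x y hx hy := by
    have e1 : i + 1 + (j + 1) = i + j := by clear hx hy; revert i j; decide
    have e2 : i + (j + 1) = i + j + 1 := by ring
    have e3 : i + 1 + j = i + j + 1 := by ring
    refine mem_grading 𝓡 |>.2 ⟨?_, ?_⟩
    · rw [fst_mul]
      exact add_mem (SetLike.mul_mem_graded hx.1 hy.1)
        (e1 ▸ SetLike.mul_mem_graded hx.2 (parityMap_mem 𝓡 hy.2))
    · rw [snd_mul]
      exact add_mem (e2 ▸ SetLike.mul_mem_graded hx.1 hy.2)
        (e3 ▸ SetLike.mul_mem_graded hx.2 (parityMap_mem 𝓡 hy.1))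
  toDecomposition := ((DirectSum.isInternal_submodule_iff_isCompl (grading 𝓡) zero_ne_one
    (by ext i; simpa using zmod_two_cases i)).2 (isCompl_grading 𝓡)).chooseDecomposition

theorem inl_mul_inl (a b : R) : inl 𝓡 a * inl 𝓡 b = inl 𝓡 (a * b) := by
  ext <;> simp [fst_mul, snd_mul]

theorem inl_mul_inr (a b : R) : inl 𝓡 a * inr 𝓡 b = inr 𝓡 (a * b) := by
  ext <;> simp [fst_mul, snd_mul]

theorem inr_mul_inl (a b : R) : inr 𝓡 a * inl 𝓡 b = inr 𝓡 (a * parityMap 𝓡 b) := by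
  ext <;> simp [fst_mul, snd_mul]

theorem inr_mul_inr (a b : R) : inr 𝓡 a * inr 𝓡 b = inl 𝓡 (a * parityMap 𝓡 b) := by
  ext <;> simp [fst_mul, snd_mul]

/-! ### Comparison of the universal cyclic pairings -/

/-- The `ν`-part `⟨a + a' ν, b + b' ν⟩ ↦ ⟨a, b'⟩ + ⟨a', ρ(b)⟩` of the pairing of `R ⊕ R ν`. -/
def oddPart : ((QueerDouble 𝓡 ⊗[k] QueerDouble 𝓡) ⧸ cyclicRelations (grading 𝓡)) →ₗ[k]
    ((R ⊗[k] R) ⧸ cyclicRelations 𝓡) :=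
  cyclicLift (grading 𝓡) ((cyclicPair 𝓡).compl₁₂ (fst 𝓡) (snd 𝓡) +
      (cyclicPair 𝓡).compl₁₂ (snd 𝓡) (parityMap 𝓡 ∘ₗ fst 𝓡))
    (by
      intro i j x hx y hy
      have h1 := cyclicPair_skew 𝓡 hx.1 hy.2
      have h2 := cyclicPair_skew 𝓡 hx.2 hy.1
      simp only [LinearMap.add_apply, LinearMap.compl₁₂_apply, LinearMap.comp_apply,
        parityMap_of_mem 𝓡 hx.1, parityMap_of_mem 𝓡 hy.1]
      rcases zmod_two_cases i with rfl | rfl <;> rcases zmod_two_cases j with rfl | rfl <;>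
        simp only [zero_add, zmod_two_one_add_one, koszulSign_zero_left, koszulSign_zero_right,
          koszulSign_one_one, one_smul, neg_smul, map_neg] at h1 h2 ⊢
      · linear_combination (norm := module) h1 + h2
      · linear_combination (norm := module) h1 - h2
      · linear_combination (norm := module) h1 + h2
      · linear_combination (norm := module) h1 - h2)
    (by
      intro i j l x hx y hy z hz
      -- The `ν`-part collects the products in which one or all three factors carry `ν`. Each such
      -- distribution contributes one cyclic relation of `R`, up to sign.
      have h1 := cyclicPair_cyclic 𝓡 hx.1 hy.1 hz.2
      have h2 := cyclicPair_cyclic 𝓡 hx.1 hy.2 hz.1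
      have h3 := cyclicPair_cyclic 𝓡 hx.2 hy.1 hz.1
      have h4 := cyclicPair_cyclic 𝓡 hx.2 hy.2 hz.2
      simp only [LinearMap.add_apply, LinearMap.compl₁₂_apply, LinearMap.comp_apply, fst_mul,
        snd_mul, map_add, parityMap_of_mem 𝓡 hx.1, parityMap_of_mem 𝓡 hy.1,
        parityMap_of_mem 𝓡 hz.1, parityMap_of_mem 𝓡 hx.2, parityMap_of_mem 𝓡 hy.2,
        parityMap_of_mem 𝓡 hz.2]
      rcases zmod_two_cases i with rfl | rfl <;> rcases zmod_two_cases j with rfl | rfl <;>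
        rcases zmod_two_cases l with rfl | rfl <;>
        simp only [zero_add, zmod_two_one_add_one, koszulSign_zero_left, koszulSign_zero_right,
          koszulSign_one_one, one_smul, neg_smul, map_neg, mul_neg, neg_neg,
          LinearMap.neg_apply] at h1 h2 h3 h4 ⊢
      · linear_combination (norm := module) h1 + h2 + h3 + h4
      · linear_combination (norm := module) h1 - h2 + h3 - h4
      · linear_combination (norm := module) h1 + h2 - h3 - h4
      · linear_combination (norm := module) h1 - h2 - h3 + h4
      · linear_combination (norm := module) -h1 + h2 + h3 - h4
      · linear_combination (norm := module) -h1 - h2 + h3 + h4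
      · linear_combination (norm := module) -h1 + h2 - h3 + h4
      · linear_combination (norm := module) -h1 - h2 - h3 - h4)

end QueerDouble

end Double

/-! ### Cyclic homology of `R ⊕ R ν` in terms of that of `R`. -/

section DoubleComparison

variable {k R : Type*} [CommRing k] [Ring R] [Algebra k R]
  (𝓡 : ZMod 2 → Submodule k R) [GradedAlgebra 𝓡]

namespace QueerDouble

theorem oddPart_cyclicPair (x y : QueerDouble 𝓡) :
    oddPart 𝓡 (cyclicPair (grading 𝓡) x y) =
      cyclicPair 𝓡 (fst 𝓡 x) (snd 𝓡 y) + cyclicPair 𝓡 (snd 𝓡 x) (parityMap 𝓡 (fst 𝓡 y)) :=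
  cyclicLift_cyclicPair ..

theorem inr_mem_of_eq {i j : ZMod 2} {a : R} (ha : a ∈ 𝓡 i) (h : i + 1 = j) :
    inr 𝓡 a ∈ grading 𝓡 j := h ▸ inr_mem 𝓡 ha

/-- `⟨a, ν⟩ = 0` for `a` in `R`. -/
theorem cyclicPair_inl_inr_one (h2 : IsUnit (2 : k)) (a : R) :
    cyclicPair (grading 𝓡) (inl 𝓡 a) (inr 𝓡 1) = 0 := by
  suffices ((cyclicPair (grading 𝓡)).flip (inr 𝓡 1)) ∘ₗ inl 𝓡 = 0 from LinearMap.congr_fun this a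
  refine linearMap_ext_homogeneous 𝓡 fun i a ha => ?_
  have hν : inr 𝓡 (1 : R) ∈ grading 𝓡 1 :=
    inr_mem_of_eq 𝓡 (SetLike.one_mem_graded 𝓡) (zero_add 1)
  -- In the triple `(a ν, ν, ν)` the middle term is `⟨1, a ν⟩ = 0` and the outer ones agree, which
  -- leaves `±2⟨a, ν⟩ = 0`.
  have h := cyclicPair_cyclic (grading 𝓡) (inr_mem 𝓡 ha) hν hν
  simp only [inr_mul_inr, parityMap_one, mul_one, one_mul, ← one_def,
    cyclicPair_one_left, smul_zero, add_zero, parityMap_of_mem 𝓡 ha, map_smul,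
    LinearMap.smul_apply] at h
  change cyclicPair (grading 𝓡) (inl 𝓡 a) (inr 𝓡 1) = 0
  refine (h2.smul_eq_zero).1 ?_
  rcases zmod_two_cases i with rfl | rfl <;>
    simp only [zero_add, zmod_two_one_add_one, koszulSign_zero_left, koszulSign_zero_right,
      koszulSign_one_one] at h
  · linear_combination (norm := module) -h
  · linear_combination (norm := module) h

/-- In the cyclic relation of `(a, b, ν)` the term `⟨ab, ν⟩` vanishes. The other two, with `ν` moved
to the right, give the skew-symmetry of `⟨a, b ν⟩` with the signs of `R`. -/
theorem cyclicPair_inl_inr_skew (h2 : IsUnit (2 : k)) {i j : ZMod 2} {a b : R} (ha : a ∈ 𝓡 i)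
    (hb : b ∈ 𝓡 j) : cyclicPair (grading 𝓡) (inl 𝓡 a) (inr 𝓡 b) +
      koszulSign k i j • cyclicPair (grading 𝓡) (inl 𝓡 b) (inr 𝓡 a) = 0 := by
  have hν : inr 𝓡 (1 : R) ∈ grading 𝓡 1 :=
    inr_mem_of_eq 𝓡 (SetLike.one_mem_graded 𝓡) (zero_add 1)
  have h := cyclicPair_cyclic (grading 𝓡) (inl_mem 𝓡 ha) (inl_mem 𝓡 hb) hν
  have h' := cyclicPair_skew (grading 𝓡) (inl_mem 𝓡 ha) (inr_mem 𝓡 hb)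
  have h'' := cyclicPair_skew (grading 𝓡) (inl_mem 𝓡 hb) (inr_mem 𝓡 ha)
  simp only [inl_mul_inl, inl_mul_inr, inr_mul_inl, mul_one, one_mul,
    cyclicPair_inl_inr_one 𝓡 h2, smul_zero, zero_add, parityMap_of_mem 𝓡 ha, map_smul,
    LinearMap.smul_apply] at h
  rcases zmod_two_cases i with rfl | rfl <;> rcases zmod_two_cases j with rfl | rfl <;>
    simp only [zero_add, zmod_two_one_add_one, koszulSign_zero_left, koszulSign_zero_right,
      koszulSign_one_one] at h h' h'' ⊢
  · linear_combination (norm := module) h' + h'' - h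
  · linear_combination (norm := module) h' + h'' - h
  · linear_combination (norm := module) h' + h'' + h
  · linear_combination (norm := module) h' - h'' + h

/-- Twice `⟨a, b⟩` and twice `⟨a ν, b ν⟩` are of the form `⟨c ν, ν⟩`, where `c` is the
supercommutator. -/
theorem two_smul_cyclicPair {i j : ZMod 2} {a b : R} (ha : a ∈ 𝓡 i) (hb : b ∈ 𝓡 j) :
    (2 : k) • cyclicPair (grading 𝓡) (inl 𝓡 a) (inl 𝓡 b) = cyclicPair (grading 𝓡)
      (inr 𝓡 (fst 𝓡 (superCommutator (grading 𝓡) (inl 𝓡 a) (inl 𝓡 b)))) (inr 𝓡 1) ∧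
    (2 : k) • cyclicPair (grading 𝓡) (inr 𝓡 a) (inr 𝓡 b) = cyclicPair (grading 𝓡)
      (inr 𝓡 (fst 𝓡 (superCommutator (grading 𝓡) (inr 𝓡 a) (inr 𝓡 b)))) (inr 𝓡 1) := by
  have hν : inr 𝓡 (1 : R) ∈ grading 𝓡 1 :=
    inr_mem_of_eq 𝓡 (SetLike.one_mem_graded 𝓡) (zero_add 1)
  -- The triple `(a ν, b, ν)` relates `⟨a ρ(b) ν, ν⟩`, `⟨b ν, a ν⟩` and `⟨ρ(a), b⟩`. With the
  -- relation for `a` and `b` exchanged, it forms a linear system that determines twice each of `⟨a,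
  -- b⟩` and `⟨a ν, b ν⟩`.
  have h := cyclicPair_cyclic (grading 𝓡) (inr_mem 𝓡 ha) (inl_mem 𝓡 hb) hν
  have h' := cyclicPair_cyclic (grading 𝓡) (inr_mem 𝓡 hb) (inl_mem 𝓡 ha) hν
  have s := cyclicPair_skew (grading 𝓡) (inl_mem 𝓡 ha) (inl_mem 𝓡 hb)
  have s' := cyclicPair_skew (grading 𝓡) (inr_mem 𝓡 ha) (inr_mem 𝓡 hb)
  rw [superCommutator_of_mem _ (inl_mem 𝓡 ha) (inl_mem 𝓡 hb),
    superCommutator_of_mem _ (inr_mem 𝓡 ha) (inr_mem 𝓡 hb)]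
  simp only [inl_mul_inl, inl_mul_inr, inr_mul_inl, inr_mul_inr, mul_one, one_mul, map_sub,
    map_smul, fst_inl, mul_smul_comm, parityMap_of_mem 𝓡 ha, parityMap_of_mem 𝓡 hb, map_smul,
    LinearMap.smul_apply, LinearMap.sub_apply] at h h' ⊢
  rcases zmod_two_cases i with rfl | rfl <;> rcases zmod_two_cases j with rfl | rfl <;>
    simp only [zero_add, zmod_two_one_add_one, koszulSign_zero_left, koszulSign_zero_right,
      koszulSign_one_one] at h h' s s' ⊢ <;> constructor
  · linear_combination (norm := module) h - h' + s + s'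
  · linear_combination (norm := module) h + h' - s + s'
  · linear_combination (norm := module) -h + h' + s - s'
  · linear_combination (norm := module) h + h' + s + s'
  · linear_combination (norm := module) -h + h' + s + s'
  · linear_combination (norm := module) -h - h' - s + s'
  · linear_combination (norm := module) h + h' + s - s'
  · linear_combination (norm := module) -h + h' + s + s'

/-- The map `⟨a, b⟩ ↦ ⟨a, b ν⟩`. -/
def ofOddPart (h2 : IsUnit (2 : k)) : ((R ⊗[k] R) ⧸ cyclicRelations 𝓡) →ₗ[k]
    ((QueerDouble 𝓡 ⊗[k] QueerDouble 𝓡) ⧸ cyclicRelations (grading 𝓡)) :=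
  cyclicLift 𝓡 ((cyclicPair (grading 𝓡)).compl₁₂ (inl 𝓡) (inr 𝓡))
    (fun i j a ha b hb => cyclicPair_inl_inr_skew 𝓡 h2 ha hb)
    (by
      intro i j l a ha b hb c hc
      -- The relation of `(a, b, c ν)` has `ν` in the left slot of two terms. The skew-symmetry of
      -- `S` and that of `⟨a, b ν⟩` together move it to the right slot.
      have h := cyclicPair_cyclic (grading 𝓡) (inl_mem 𝓡 ha) (inl_mem 𝓡 hb) (inr_mem 𝓡 hc)
      have s1 := cyclicPair_skew (grading 𝓡) (inl_mem 𝓡 ha)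
        (inr_mem 𝓡 (SetLike.mul_mem_graded hb hc))
      have s2 := cyclicPair_skew (grading 𝓡) (inl_mem 𝓡 hb)
        (inr_mem 𝓡 (SetLike.mul_mem_graded hc ha))
      have t1 := cyclicPair_inl_inr_skew 𝓡 h2 ha (SetLike.mul_mem_graded hb hc)
      have t2 := cyclicPair_inl_inr_skew 𝓡 h2 hb (SetLike.mul_mem_graded hc ha)
      simp only [inl_mul_inl, inl_mul_inr, inr_mul_inl, parityMap_of_mem 𝓡 ha, mul_smul_comm,
        map_smul, LinearMap.smul_apply] at h
      simp only [LinearMap.compl₁₂_apply]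
      rcases zmod_two_cases i with rfl | rfl <;> rcases zmod_two_cases j with rfl | rfl <;>
        rcases zmod_two_cases l with rfl | rfl <;>
        simp only [zero_add, add_zero, zmod_two_one_add_one, koszulSign_zero_left,
          koszulSign_zero_right, koszulSign_one_one] at h s1 s2 t1 t2 ⊢
      · linear_combination (norm := module) h - s1 - s2 + t1 + t2
      · linear_combination (norm := module) h - s1 - s2 + t1 + t2
      · linear_combination (norm := module) h - s1 - s2 + t1 + t2
      · linear_combination (norm := module) h - s1 - s2 + t1 + t2
      · linear_combination (norm := module) -h - s1 - s2 + t1 + t2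
      · linear_combination (norm := module) -h + s1 - s2 - t1 + t2
      · linear_combination (norm := module) -h - s1 + s2 + t1 - t2
      · linear_combination (norm := module) -h + s1 + s2 - t1 - t2)

theorem ofOddPart_cyclicPair (h2 : IsUnit (2 : k)) (a b : R) :
    ofOddPart 𝓡 h2 (cyclicPair 𝓡 a b) = cyclicPair (grading 𝓡) (inl 𝓡 a) (inr 𝓡 b) :=
  cyclicLift_cyclicPair ..

/-- Compares two skew-symmetries of mixed pairs. It matches the second summand in the formula for
`oddPart`. -/
theorem cyclicPair_inr_inl (h2 : IsUnit (2 : k)) {i j : ZMod 2} {a b : R} (ha : a ∈ 𝓡 i)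
    (hb : b ∈ 𝓡 j) : cyclicPair (grading 𝓡) (inr 𝓡 a) (inl 𝓡 b) =
      cyclicPair (grading 𝓡) (inl 𝓡 a) (inr 𝓡 (parityMap 𝓡 b)) := by
  have h := cyclicPair_skew (grading 𝓡) (inr_mem 𝓡 ha) (inl_mem 𝓡 hb)
  have h' := cyclicPair_inl_inr_skew 𝓡 h2 ha hb
  rw [parityMap_of_mem 𝓡 hb, map_smul, map_smul]
  rcases zmod_two_cases i with rfl | rfl <;> rcases zmod_two_cases j with rfl | rfl <;>
    simp only [zero_add, zmod_two_one_add_one, koszulSign_zero_left, koszulSign_zero_right,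
      koszulSign_one_one] at h h' ⊢
  · linear_combination (norm := module) h - h'
  · linear_combination (norm := module) h + h'
  · linear_combination (norm := module) h - h'
  · linear_combination (norm := module) h + h'

/-- Mixed pairs are recovered from their `ν`-part, while unmixed pairs depend, after doubling, only
on their commutator. On elements with zero commutator `ofOddPart` is therefore inverse to `oddPart`,
once `2` is cancelled. -/
theorem two_smul_eq (h2 : IsUnit (2 : k))
    (u : (QueerDouble 𝓡 ⊗[k] QueerDouble 𝓡) ⧸ cyclicRelations (grading 𝓡)) :
    (2 : k) • u = (2 : k) • ofOddPart 𝓡 h2 (oddPart 𝓡 u) + cyclicPair (grading 𝓡)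
      (inr 𝓡 (fst 𝓡 (cyclicCommutator (grading 𝓡) u))) (inr 𝓡 1) := by
  suffices h : (2 : k) • LinearMap.id = (2 : k) • (ofOddPart 𝓡 h2 ∘ₗ oddPart 𝓡) +
      (cyclicPair (grading 𝓡)).flip (inr 𝓡 1) ∘ₗ inr 𝓡 ∘ₗ fst 𝓡 ∘ₗ cyclicCommutator (grading 𝓡) from
    LinearMap.congr_fun h u
  refine cyclicQuotient_ext (grading 𝓡) fun i j x hx y hy => ?_
  simp only [LinearMap.smul_apply, LinearMap.id_apply, LinearMap.add_apply, LinearMap.comp_apply,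
    LinearMap.flip_apply, oddPart_cyclicPair, cyclicCommutator_cyclicPair, map_add,
    ofOddPart_cyclicPair]
  obtain ⟨hx1, hx2⟩ := hx
  obtain ⟨hy1, hy2⟩ := hy
  have e1 := (two_smul_cyclicPair 𝓡 hx1 hy1).1
  have e2 := (two_smul_cyclicPair 𝓡 hx2 hy2).2
  have e3 := cyclicPair_inr_inl 𝓡 h2 hx2 hy1
  have e4 : fst 𝓡 (superCommutator (grading 𝓡) x y) =
      fst 𝓡 (superCommutator (grading 𝓡) (inl 𝓡 (fst 𝓡 x)) (inl 𝓡 (fst 𝓡 y))) +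
      fst 𝓡 (superCommutator (grading 𝓡) (inr 𝓡 (snd 𝓡 x)) (inr 𝓡 (snd 𝓡 y))) := by
    conv_lhs => rw [← inl_add_inr 𝓡 x, ← inl_add_inr 𝓡 y]
    simp only [map_add, LinearMap.add_apply]
    rw [superCommutator_of_mem _ (inl_mem 𝓡 hx1) (inr_mem 𝓡 hy2),
      superCommutator_of_mem _ (inr_mem 𝓡 hx2) (inl_mem 𝓡 hy1)]
    simp [inl_mul_inr, inr_mul_inl]
  rw [e4]
  conv_lhs => rw [← inl_add_inr 𝓡 x, ← inl_add_inr 𝓡 y]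
  simp only [map_add, LinearMap.add_apply]
  linear_combination (norm := module) e1 + e2 + (2 : k) • e3

theorem eq_zero_of_oddPart_eq_zero (h2 : IsUnit (2 : k))
    {u : (QueerDouble 𝓡 ⊗[k] QueerDouble 𝓡) ⧸ cyclicRelations (grading 𝓡)}
    (hu : cyclicCommutator (grading 𝓡) u = 0) (ho : oddPart 𝓡 u = 0) : u = 0 := by
  refine h2.smul_eq_zero.1 ?_
  rw [two_smul_eq 𝓡 h2, hu, ho]
  simp

/-- Ensures that `oddPart` carries `HC₁(S)` into `HC₁(R)`. Read backwards, it gives the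
`ν`-component of the cycle condition for lifts. -/
theorem cyclicCommutator_oddPart
    (u : (QueerDouble 𝓡 ⊗[k] QueerDouble 𝓡) ⧸ cyclicRelations (grading 𝓡)) :
    cyclicCommutator 𝓡 (oddPart 𝓡 u) = snd 𝓡 (cyclicCommutator (grading 𝓡) u) := by
  suffices h : cyclicCommutator 𝓡 ∘ₗ oddPart 𝓡 = snd 𝓡 ∘ₗ cyclicCommutator (grading 𝓡) from
    LinearMap.congr_fun h u
  refine cyclicQuotient_ext (grading 𝓡) fun i j x hx y hy => ?_
  simp only [LinearMap.comp_apply, oddPart_cyclicPair, cyclicCommutator_cyclicPair, map_add]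
  rw [superCommutator_of_mem _ hx hy]
  obtain ⟨hx1, hx2⟩ := hx
  obtain ⟨hy1, hy2⟩ := hy
  rw [superCommutator_of_mem _ hx1 hy2, superCommutator_of_mem _ hx2 (parityMap_mem 𝓡 hy1)]
  simp only [map_sub, map_smul, snd_mul, parityMap_of_mem 𝓡 hx1, parityMap_of_mem 𝓡 hy1]
  rcases zmod_two_cases i with rfl | rfl <;> rcases zmod_two_cases j with rfl | rfl <;>
    simp only [zero_add, zmod_two_one_add_one, koszulSign_zero_left, koszulSign_zero_right,
      koszulSign_one_one, one_smul, neg_smul, mul_neg, neg_mul] <;> abel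

end QueerDouble

end DoubleComparison

/-! ## The trace pairing of matrices -/

section TracePair

variable {k S ι : Type*} [CommRing k] [Ring S] [Algebra k S] [Fintype ι] [DecidableEq ι]
  (𝒮 : ZMod 2 → Submodule k S) [GradedAlgebra 𝒮]

/-- The pairing `(X, Y) ↦ ∑ ⟨X p q, Y q p⟩` of matrices. -/
def tracePair : Matrix ι ι S →ₗ[k] Matrix ι ι S →ₗ[k] ((S ⊗[k] S) ⧸ cyclicRelations 𝒮) :=
  ∑ p, ∑ q, (cyclicPair 𝒮).compl₁₂ (Matrix.entryLinearMap k S p q) (Matrix.entryLinearMap k S q p)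

theorem tracePair_apply (X Y : Matrix ι ι S) :
    tracePair 𝒮 X Y = ∑ p, ∑ q, cyclicPair 𝒮 (X p q) (Y q p) := by
  simp [tracePair, LinearMap.sum_apply]

theorem tracePair_single_single (p q r s : ι) (a b : S) :
    tracePair 𝒮 (Matrix.single p q a) (Matrix.single r s b) =
      if p = s ∧ q = r then cyclicPair 𝒮 a b else 0 := by
  rw [tracePair_apply, Finset.sum_eq_single p, Finset.sum_eq_single q]
  · by_cases hp : p = s <;> by_cases hq : q = r <;>
      simp [hp, hq, eq_comm]
  · intro v _ hv
    rw [Matrix.single_apply_of_col_ne _ _ hv.symm, map_zero, LinearMap.zero_apply]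
  · simp
  · intro u _ hu
    refine Finset.sum_eq_zero fun v _ => ?_
    rw [Matrix.single_apply_of_row_ne hu.symm, map_zero, LinearMap.zero_apply]
  · simp

theorem tracePair_skew {i j : ZMod 2} {X Y : Matrix ι ι S} (hX : ∀ p q, X p q ∈ 𝒮 i)
    (hY : ∀ p q, Y p q ∈ 𝒮 j) :
    tracePair 𝒮 X Y + koszulSign k i j • tracePair 𝒮 Y X = 0 := by
  rw [tracePair_apply, tracePair_apply, Finset.sum_comm (f := fun p q => cyclicPair 𝒮 (Y p q) _)]
  simp only [Finset.smul_sum, ← Finset.sum_add_distrib, cyclicPair_skew 𝒮 (hX _ _) (hY _ _),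
    Finset.sum_const_zero]

theorem tracePair_mul (X Y Z : Matrix ι ι S) : tracePair 𝒮 (X * Y) Z =
    ∑ p, ∑ q, ∑ r, cyclicPair 𝒮 (X p q * Y q r) (Z r p) := by
  rw [tracePair_apply]
  refine Finset.sum_congr rfl fun p _ => ?_
  rw [Finset.sum_comm]
  refine Finset.sum_congr rfl fun q _ => ?_
  rw [Matrix.mul_apply, map_sum, LinearMap.sum_apply]

/-- After cyclic reindexing of the triple sums, this is the cyclic relation of the entries at each
`(p, q, r)`. No index signs arise, all indices being even. -/
theorem tracePair_cyclic {i j l : ZMod 2} {X Y Z : Matrix ι ι S} (hX : ∀ p q, X p q ∈ 𝒮 i)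
    (hY : ∀ p q, Y p q ∈ 𝒮 j) (hZ : ∀ p q, Z p q ∈ 𝒮 l) :
    koszulSign k i l • tracePair 𝒮 (X * Y) Z + koszulSign k j i • tracePair 𝒮 (Y * Z) X +
      koszulSign k l j • tracePair 𝒮 (Z * X) Y = 0 := by
  have e1 : tracePair 𝒮 (Y * Z) X = ∑ p, ∑ q, ∑ r, cyclicPair 𝒮 (Y q r * Z r p) (X p q) := by
    rw [tracePair_mul]
    simp_rw [Finset.sum_comm (s := Finset.univ (α := ι)) (f := fun q r => cyclicPair 𝒮 (Y _ q * Z q r) _)]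
    rw [Finset.sum_comm]
  have e2 : tracePair 𝒮 (Z * X) Y = ∑ p, ∑ q, ∑ r, cyclicPair 𝒮 (Z r p * X p q) (Y q r) := by
    rw [tracePair_mul, Finset.sum_comm]
    refine Finset.sum_congr rfl fun p _ => ?_
    rw [Finset.sum_comm]
  rw [e1, e2, tracePair_mul]
  simp only [Finset.smul_sum, ← Finset.sum_add_distrib,
    cyclicPair_cyclic 𝒮 (hX _ _) (hY _ _) (hZ _ _), Finset.sum_const_zero]

theorem cyclicCommutator_tracePair {i j : ZMod 2} {X Y : Matrix ι ι S} (hX : ∀ p q, X p q ∈ 𝒮 i)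
    (hY : ∀ p q, Y p q ∈ 𝒮 j) : cyclicCommutator 𝒮 (tracePair 𝒮 X Y) =
      (X * Y - koszulSign k i j • (Y * X)).trace := by
  rw [Matrix.trace_sub, Matrix.trace_smul]
  simp only [tracePair_apply, map_sum, cyclicCommutator_cyclicPair,
    superCommutator_of_mem 𝒮 (hX _ _) (hY _ _), Matrix.trace, Matrix.diag_apply, Matrix.mul_apply,
    Finset.sum_sub_distrib, Finset.smul_sum]
  rw [Finset.sum_comm (f := fun p q => koszulSign k i j • (Y p q * X q p))]

theorem tracePair_cube_add {X Y : Matrix ι ι S} (hX : ∀ p q, X p q ∈ 𝒮 1)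
    (hY : ∀ p q, Y p q ∈ 𝒮 1) : tracePair 𝒮 ((X + Y) * (X + Y)) (X + Y) =
      tracePair 𝒮 (X * X) X + tracePair 𝒮 (Y * Y) Y := by
  have h := tracePair_cyclic 𝒮 hX hX hY
  have h' := tracePair_cyclic 𝒮 hY hY hX
  simp only [koszulSign_one_one] at h h'
  simp only [add_mul, mul_add, map_add, LinearMap.add_apply]
  linear_combination (norm := module) -h - h'

/-- The additive map sending `t` to `⟨t₁², t₁⟩`, where `t₁` is the odd part of `t`. -/
def cyclicCube : S →+ ((S ⊗[k] S) ⧸ cyclicRelations 𝒮) :=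
  AddMonoidHom.mk' (fun t => cyclicPair 𝒮 (GradedAlgebra.proj 𝒮 1 t * GradedAlgebra.proj 𝒮 1 t)
    (GradedAlgebra.proj 𝒮 1 t)) fun a b => by
      simp only [map_add (GradedAlgebra.proj 𝒮 1)]
      exact cyclicPair_cube_add 𝒮 (proj_mem 𝒮 1 a) (proj_mem 𝒮 1 b)

/-- The additive map sending `X` to `∑ ⟨X₁² p q, X₁ q p⟩`, where `X₁` is the odd part of `X`. -/
def traceCube : Matrix ι ι S →+ ((S ⊗[k] S) ⧸ cyclicRelations 𝒮) :=
  AddMonoidHom.mk' (fun X => tracePair 𝒮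
    (X.map (GradedAlgebra.proj 𝒮 1) * X.map (GradedAlgebra.proj 𝒮 1))
    (X.map (GradedAlgebra.proj 𝒮 1))) fun X Y => by
      rw [Matrix.map_add _ (map_add (GradedAlgebra.proj 𝒮 1))]
      exact tracePair_cube_add 𝒮 (fun p q => proj_mem 𝒮 1 (X p q)) (fun p q => proj_mem 𝒮 1 (Y p q))

theorem traceCube_single (p q : ι) (a : S) :
    traceCube 𝒮 (Matrix.single p q a) = if p = q then cyclicCube 𝒮 a else 0 := by
  have h : (Matrix.single p q a).map (GradedAlgebra.proj 𝒮 1) =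
      Matrix.single p q (GradedAlgebra.proj 𝒮 1 a) := by
    ext u v
    simp only [Matrix.map_apply, Matrix.single_apply]
    split_ifs <;> simp
  change tracePair 𝒮 (_ * _) _ = _
  rw [h]
  split_ifs with hpq
  · subst hpq
    rw [Matrix.single_mul_single_same, tracePair_single_single, if_pos ⟨rfl, rfl⟩]
    rfl
  · rw [Matrix.single_mul_single_of_ne _ _ _ _ (Ne.symm hpq)]
    simp

/-- Both sides are additive in `X`, so matrix units suffice. Off-diagonal ones have square zero. -/
theorem traceCube_eq (X : Matrix ι ι S) : traceCube 𝒮 X = cyclicCube 𝒮 X.trace := by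
  conv_lhs => rw [Matrix.matrix_eq_sum_single X]
  simp [map_sum, traceCube_single, Matrix.trace]

/-- Makes the pairing vanish on the boundaries `[x, x] ∧ x`. Cyclicity alone only gives `3⟨X², X⟩ =
0`, hence the condition on the trace. -/
theorem tracePair_cube {X : Matrix ι ι S} (hX : ∀ p q, X p q ∈ 𝒮 1)
    (hT : X.trace ∈ commutatorSpan 𝒮) : tracePair 𝒮 (X * X) X = 0 := by
  have h : X.map (GradedAlgebra.proj 𝒮 1) = X := by
    ext p q
    rw [Matrix.map_apply, proj_of_mem 𝒮 (hX p q), if_pos rfl]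
  have h' := traceCube_eq 𝒮 X
  change tracePair 𝒮 (_ * _) _ = _ at h'
  rw [h] at h'
  rw [h']
  exact cyclicPair_cube_of_mem_commutatorSpan 𝒮 hT

end TracePair

/-! ## The exterior square modulo boundaries -/

namespace LieSuperalgebra

variable {k L M : Type*} [CommRing k] [AddCommGroup L] [Module k L] [AddCommGroup M] [Module k M]
  (g : LieSuperalgebra k L)

theorem exists_homogeneous_add (x : L) : ∃ y ∈ g.grading 0, ∃ z ∈ g.grading 1, y + z = x :=
  Submodule.mem_sup.1 (g.isCompl.sup_eq_top.symm ▸ Submodule.mem_top)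

theorem ext_homogeneous {f f' : L →ₗ[k] M} (h : ∀ i, ∀ x ∈ g.grading i, f x = f' x) : f = f' := by
  ext x
  obtain ⟨y, hy, z, hz, rfl⟩ := g.exists_homogeneous_add x
  rw [map_add, map_add, h _ y hy, h _ z hz]

theorem ext_homogeneous₂ {f f' : L →ₗ[k] L →ₗ[k] M}
    (h : ∀ i j, ∀ x ∈ g.grading i, ∀ y ∈ g.grading j, f x y = f' x y) : f = f' :=
  g.ext_homogeneous fun i x hx => g.ext_homogeneous fun j y hy => h i j x hx y hy

/-- The class of `x ∧ y` modulo boundaries. -/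
def wedgeClass : L →ₗ[k] L →ₗ[k] g.Wedge2 ⧸ g.boundaries :=
  (TensorProduct.mk k L L).compr₂ (g.boundaries.mkQ ∘ₗ g.skewRelations.mkQ)

theorem mkQ_wedge (x y : L) : g.boundaries.mkQ (g.wedge x y) = g.wedgeClass x y := rfl

theorem wedgeClass_skew {i j : ZMod 2} {x y : L} (hx : x ∈ g.grading i) (hy : y ∈ g.grading j) :
    g.wedgeClass x y + koszulSign k i j • g.wedgeClass y x = 0 := by
  have h : g.wedge x y + koszulSign k i j • g.wedge y x = 0 := by
    simp only [wedge, ← map_smul, ← map_add]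
    exact (Submodule.Quotient.mk_eq_zero _).2 (Submodule.subset_span ⟨i, j, x, hx, y, hy, rfl⟩)
  rw [← mkQ_wedge, ← mkQ_wedge, ← map_smul, ← map_add, h, map_zero]

theorem wedgeClass_jacobi {i j l : ZMod 2} {x y z : L} (hx : x ∈ g.grading i)
    (hy : y ∈ g.grading j) (hz : z ∈ g.grading l) :
    koszulSign k i l • g.wedgeClass (g.bracket x y) z +
      koszulSign k j i • g.wedgeClass (g.bracket y z) x +
      koszulSign k l j • g.wedgeClass (g.bracket z x) y = 0 := by
  simp only [← mkQ_wedge, ← map_smul, ← map_add]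
  exact (Submodule.Quotient.mk_eq_zero _).2
    (Submodule.subset_span (Or.inl ⟨i, j, l, x, hx, y, hy, z, hz, rfl⟩))

/-- The Jacobi boundary rewritten by skew-symmetry as a derivation rule. All later computations with
classes start from this form. -/
theorem wedgeClass_bracket {i j l : ZMod 2} {x y z : L} (hx : x ∈ g.grading i)
    (hy : y ∈ g.grading j) (hz : z ∈ g.grading l) :
    g.wedgeClass x (g.bracket y z) = g.wedgeClass (g.bracket x y) z +
      koszulSign k i j • g.wedgeClass y (g.bracket x z) := by
  have h := g.wedgeClass_jacobi hx hy hz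
  have s1 := g.wedgeClass_skew hx (g.bracket_mem hy hz)
  have s2 := g.wedgeClass_skew hy (g.bracket_mem hx hz)
  have s3 := congrArg (fun t => g.wedgeClass t y) (g.skew hx hz)
  simp only [map_add, map_smul, LinearMap.add_apply, LinearMap.smul_apply, map_zero,
    LinearMap.zero_apply] at s3
  rcases zmod_two_cases i with rfl | rfl <;> rcases zmod_two_cases j with rfl | rfl <;>
    rcases zmod_two_cases l with rfl | rfl <;>
    simp only [zero_add, add_zero, zmod_two_one_add_one, koszulSign_zero_left,
      koszulSign_zero_right, koszulSign_one_one] at h s1 s2 s3 ⊢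
  · linear_combination (norm := module) -h + s1 - s2 + s3
  · linear_combination (norm := module) -h + s1 - s2 + s3
  · linear_combination (norm := module) -h + s1 - s2 + s3
  · linear_combination (norm := module) -h + s1 - s2 - s3
  · linear_combination (norm := module) -h + s1 - s2 + s3
  · linear_combination (norm := module) h + s1 - s2 + s3
  · linear_combination (norm := module) -h + s1 + s2 + s3
  · linear_combination (norm := module) h + s1 + s2 - s3

/-- A bilinear map vanishing on the relations of `Λ²` and on boundaries factors through the
exterior square modulo boundaries. -/
def wedgeLift (f : L →ₗ[k] L →ₗ[k] M)
    (hs : ∀ i j, ∀ x ∈ g.grading i, ∀ y ∈ g.grading j, f x y + koszulSign k i j • f y x = 0)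
    (hj : ∀ i j l, ∀ x ∈ g.grading i, ∀ y ∈ g.grading j, ∀ z ∈ g.grading l,
      koszulSign k i l • f (g.bracket x y) z + koszulSign k j i • f (g.bracket y z) x +
        koszulSign k l j • f (g.bracket z x) y = 0)
    (hc : ∀ x ∈ g.grading 1, f (g.bracket x x) x = 0) : g.Wedge2 ⧸ g.boundaries →ₗ[k] M :=
  g.boundaries.liftQ (g.skewRelations.liftQ (TensorProduct.lift f) <| by
      refine Submodule.span_le.2 ?_
      rintro _ ⟨i, j, x, hx, y, hy, rfl⟩
      simpa using hs i j x hx y hy) <| by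
    refine Submodule.span_le.2 ?_
    rintro _ (⟨i, j, l, x, hx, y, hy, z, hz, rfl⟩ | ⟨x, hx, rfl⟩)
    · simp only [SetLike.mem_coe, LinearMap.mem_ker, map_add, map_smul]
      exact hj i j l x hx y hy z hz
    · exact hc x hx

/-- The differential `x ∧ y ↦ [x, y]` modulo boundaries. -/
def d2Class : g.Wedge2 ⧸ g.boundaries →ₗ[k] L :=
  g.boundaries.liftQ g.d2 g.boundaries_le_cycles

theorem d2Class_wedgeClass (x y : L) : g.d2Class (g.wedgeClass x y) = g.bracket x y := rfl

theorem wedgeQuotient_ext {f f' : g.Wedge2 ⧸ g.boundaries →ₗ[k] M}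
    (h : ∀ x y, f (g.wedgeClass x y) = f' (g.wedgeClass x y)) : f = f' := by
  refine Submodule.linearMap_qext _ (Submodule.linearMap_qext _ (TensorProduct.ext' fun x y => ?_))
  exact h x y

end LieSuperalgebra

/-! ## Lie superalgebras of matrices -/

section Model

variable {k S L ι : Type*} [CommRing k] [Ring S] [Algebra k S] [Fintype ι] [DecidableEq ι]
  [AddCommGroup L] [Module k L]

/-- A Lie superalgebra of square matrices over a superalgebra `S` with all indices even that
consists of matrices with trace in `[S, S]`, and contains all matrix units `single p q a` with
`p ≠ q` and `single p p 1`. -/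
structure MatrixModel (𝒮 : ZMod 2 → Submodule k S) [GradedAlgebra 𝒮] (g : LieSuperalgebra k L)
    (ι : Type*) [Fintype ι] [DecidableEq ι] where
  toMatrix : L →ₗ[k] Matrix ι ι S
  injective : Function.Injective toMatrix
  mem_grading : ∀ {i : ZMod 2} {x : L}, x ∈ g.grading i ↔ ∀ p q, toMatrix x p q ∈ 𝒮 i
  bracket : ∀ {i j : ZMod 2} {x y : L}, x ∈ g.grading i → y ∈ g.grading j →
    toMatrix (g.bracket x y) =
      toMatrix x * toMatrix y - koszulSign k i j • (toMatrix y * toMatrix x)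
  trace_mem : ∀ x, (toMatrix x).trace ∈ commutatorSpan 𝒮
  exists_single : ∀ {p q : ι}, p ≠ q → ∀ a, ∃ x, toMatrix x = Matrix.single p q a
  exists_single_one : ∀ p : ι, ∃ x, toMatrix x = Matrix.single p p 1

namespace MatrixModel

variable {𝒮 : ZMod 2 → Submodule k S} [GradedAlgebra 𝒮] {g : LieSuperalgebra k L}
  (m : MatrixModel 𝒮 g ι)

/-- The element of `L` with matrix `single p q a` for `p ≠ q`, and `0` for `p = q`. -/
def unit (p q : ι) : S →ₗ[k] L :=
  if h : p ≠ q then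
    (LinearEquiv.ofInjective m.toMatrix m.injective).symm.toLinearMap ∘ₗ
      (Matrix.singleLinearMap k p q).codRestrict (LinearMap.range m.toMatrix)
        (fun a => m.exists_single h a)
  else 0

/-- The element of `L` with matrix `single p p 1`. -/
def idem (p : ι) : L := (m.exists_single_one p).choose

theorem toMatrix_idem (p : ι) : m.toMatrix (m.idem p) = Matrix.single p p 1 :=
  (m.exists_single_one p).choose_spec

theorem toMatrix_unit {p q : ι} (h : p ≠ q) (a : S) :
    m.toMatrix (m.unit p q a) = Matrix.single p q a := by
  rw [unit, dif_pos h]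
  exact congrArg Subtype.val ((LinearEquiv.ofInjective m.toMatrix m.injective).apply_symm_apply
    ⟨Matrix.single p q a, m.exists_single h a⟩)

theorem unit_self (p : ι) : m.unit p p = 0 := dif_neg (not_not.2 rfl)

theorem single_mem {i : ZMod 2} {a : S} (ha : a ∈ 𝒮 i) (p q u v : ι) :
    Matrix.single p q a u v ∈ 𝒮 i := by
  rw [Matrix.single_apply]
  split_ifs
  · exact ha
  · exact zero_mem _

theorem unit_mem {i : ZMod 2} {a : S} (ha : a ∈ 𝒮 i) (p q : ι) : m.unit p q a ∈ g.grading i := by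
  by_cases h : p = q
  · subst h
    rw [unit_self]
    exact zero_mem _
  · rw [m.mem_grading, m.toMatrix_unit h]
    exact single_mem ha p q

theorem idem_mem (p : ι) : m.idem p ∈ g.grading 0 := by
  rw [m.mem_grading, toMatrix_idem]
  exact single_mem (SetLike.one_mem_graded 𝒮) p p

theorem bracket_unit_unit {i j : ZMod 2} {a b : S} (ha : a ∈ 𝒮 i) (hb : b ∈ 𝒮 j) {p q r : ι}
    (hpq : p ≠ q) (hqr : q ≠ r) (hpr : p ≠ r) :
    g.bracket (m.unit p q a) (m.unit q r b) = m.unit p r (a * b) := by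
  apply m.injective
  rw [m.bracket (m.unit_mem ha p q) (m.unit_mem hb q r), m.toMatrix_unit hpq, m.toMatrix_unit hqr,
    m.toMatrix_unit hpr, Matrix.single_mul_single_same,
    Matrix.single_mul_single_of_ne _ _ _ _ hpr.symm, smul_zero, sub_zero]

theorem bracket_unit_unit' {i j : ZMod 2} {a b : S} (ha : a ∈ 𝒮 i) (hb : b ∈ 𝒮 j) {p q r : ι}
    (hpq : p ≠ q) (hqr : q ≠ r) (hpr : p ≠ r) :
    g.bracket (m.unit q r a) (m.unit p q b) = -(koszulSign k i j • m.unit p r (b * a)) := by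
  apply m.injective
  rw [m.bracket (m.unit_mem ha q r) (m.unit_mem hb p q), m.toMatrix_unit hpq, m.toMatrix_unit hqr,
    map_neg, map_smul, m.toMatrix_unit hpr, Matrix.single_mul_single_same,
    Matrix.single_mul_single_of_ne _ _ _ _ hpr.symm, zero_sub]

theorem bracket_unit_unit_of_ne {i j : ZMod 2} {a b : S} (ha : a ∈ 𝒮 i) (hb : b ∈ 𝒮 j)
    {p q r s : ι} (hpq : p ≠ q) (hrs : r ≠ s) (hqr : q ≠ r) (hps : p ≠ s) :
    g.bracket (m.unit p q a) (m.unit r s b) = 0 := by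
  apply m.injective
  rw [m.bracket (m.unit_mem ha p q) (m.unit_mem hb r s), m.toMatrix_unit hpq, m.toMatrix_unit hrs,
    Matrix.single_mul_single_of_ne _ _ _ _ hqr, Matrix.single_mul_single_of_ne _ _ _ _ hps.symm,
    smul_zero, sub_zero, map_zero]

theorem toMatrix_bracket_unit_unit {i j : ZMod 2} {a b : S} (ha : a ∈ 𝒮 i) (hb : b ∈ 𝒮 j)
    {p q : ι} (hpq : p ≠ q) : m.toMatrix (g.bracket (m.unit p q a) (m.unit q p b)) =
      Matrix.single p p (a * b) - koszulSign k i j • Matrix.single q q (b * a) := by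
  rw [m.bracket (m.unit_mem ha p q) (m.unit_mem hb q p), m.toMatrix_unit hpq,
    m.toMatrix_unit hpq.symm, Matrix.single_mul_single_same, Matrix.single_mul_single_same]

theorem toMatrix_bracket_unit_unit_one (a : S) {p q : ι} (hpq : p ≠ q) :
    m.toMatrix (g.bracket (m.unit p q a) (m.unit q p 1)) =
      Matrix.single p p a - Matrix.single q q a := by
  suffices m.toMatrix ∘ₗ g.bracket.flip (m.unit q p 1) ∘ₗ m.unit p q =
      Matrix.singleLinearMap k p p - Matrix.singleLinearMap k q q from LinearMap.congr_fun this a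
  refine linearMap_ext_homogeneous 𝒮 fun i a ha => ?_
  have := m.toMatrix_bracket_unit_unit ha (SetLike.one_mem_graded 𝒮) hpq
  rw [mul_one, one_mul, koszulSign_zero_right, one_smul] at this
  exact this

theorem bracket_idem_unit {i : ZMod 2} {a : S} (ha : a ∈ 𝒮 i) (p : ι) {r s : ι} (hrs : r ≠ s) :
    g.bracket (m.idem p) (m.unit r s a) =
      ((if p = r then 1 else 0) - (if p = s then 1 else 0) : k) • m.unit r s a := by
  apply m.injective
  rw [m.bracket (m.idem_mem p) (m.unit_mem ha r s), map_smul, m.toMatrix_unit hrs, toMatrix_idem,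
    koszulSign_zero_left, one_smul]
  by_cases hr : p = r
  · subst hr
    rw [Matrix.single_mul_single_same, Matrix.single_mul_single_of_ne _ _ _ _ hrs.symm,
      if_pos rfl, if_neg hrs]
    simp
  · rw [Matrix.single_mul_single_of_ne _ _ _ _ hr, if_neg hr]
    by_cases hs : p = s
    · subst hs
      rw [Matrix.single_mul_single_same, if_pos rfl]
      simp
    · rw [Matrix.single_mul_single_of_ne _ _ _ _ (Ne.symm hs), if_neg hs]
      simp

/-- `E_pp(1)` acts on matrix units by weights. By the derivation rule, a wedge of total weight
invertible in `k` is determined by the bracket of its factors. -/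
theorem wedgeClass_idem_bracket (p : ι) {i j : ZMod 2} {a b : S} (ha : a ∈ 𝒮 i) (hb : b ∈ 𝒮 j)
    {q r s t : ι} (hqr : q ≠ r) (hst : s ≠ t) :
    g.wedgeClass (m.idem p) (g.bracket (m.unit q r a) (m.unit s t b)) =
      (((if p = q then 1 else 0) - (if p = r then 1 else 0)) +
        ((if p = s then 1 else 0) - (if p = t then 1 else 0)) : k) •
        g.wedgeClass (m.unit q r a) (m.unit s t b) := by
  rw [g.wedgeClass_bracket (m.idem_mem p) (m.unit_mem ha q r) (m.unit_mem hb s t),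
    m.bracket_idem_unit ha p hqr, m.bracket_idem_unit hb p hst, koszulSign_zero_left, one_smul,
    map_smul, map_smul, LinearMap.smul_apply, add_smul]

/-- The bracket is zero, while the weight of `E_pp(1)` is `2` if `p = r` and `1` otherwise. -/
theorem wedgeClass_unit_unit_of_ne (h2 : IsUnit (2 : k)) {i j : ZMod 2} {a b : S} (ha : a ∈ 𝒮 i)
    (hb : b ∈ 𝒮 j) {p q r s : ι} (hpq : p ≠ q) (hrs : r ≠ s) (hqr : q ≠ r) (hps : p ≠ s) :
    g.wedgeClass (m.unit p q a) (m.unit r s b) = 0 := by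
  have h := m.wedgeClass_idem_bracket p ha hb hpq hrs
  rw [m.bracket_unit_unit_of_ne ha hb hpq hrs hqr hps, map_zero, if_pos rfl, if_neg hpq,
    if_neg hps] at h
  split_ifs at h
  · rw [show (1 - 0 + (1 - 0) : k) = 2 by norm_num] at h
    exact h2.smul_eq_zero.1 h.symm
  · rw [show (1 - 0 + (0 - 0) : k) = 1 by norm_num, one_smul] at h
    exact h.symm

/-- The off-diagonal part of the exterior square modulo boundaries. -/
def unitClass (p q : ι) : S →ₗ[k] g.Wedge2 ⧸ g.boundaries :=
  g.wedgeClass (m.idem p) ∘ₗ m.unit p q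

/-- Here the weight of `E_pp(1)` is `1`. In particular the class does not depend on the middle index
or on the factorization of `ab`. -/
theorem wedgeClass_unit_unit {i j : ZMod 2} {a b : S} (ha : a ∈ 𝒮 i) (hb : b ∈ 𝒮 j) {p q r : ι}
    (hpq : p ≠ q) (hqr : q ≠ r) (hpr : p ≠ r) :
    g.wedgeClass (m.unit p q a) (m.unit q r b) = m.unitClass p r (a * b) := by
  have h := m.wedgeClass_idem_bracket p ha hb hpq hqr
  rw [m.bracket_unit_unit ha hb hpq hqr hpr, if_pos rfl, if_neg hpq, if_neg hpr,
    show (1 - 0 + (0 - 0) : k) = 1 by norm_num, one_smul] at h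
  exact h.symm

/-- The classes `E_{pq}(a) ∧ E_{qp}(b)`. -/
def cartanClass (p q : ι) : S →ₗ[k] S →ₗ[k] g.Wedge2 ⧸ g.boundaries :=
  g.wedgeClass.compl₁₂ (m.unit p q) (m.unit q p)

theorem cartanClass_apply (p q : ι) (a b : S) :
    m.cartanClass p q a b = g.wedgeClass (m.unit p q a) (m.unit q p b) := rfl

theorem cartanClass_self (p : ι) (a b : S) : m.cartanClass p p a b = 0 := by
  rw [cartanClass_apply, unit_self, LinearMap.zero_apply, map_zero, LinearMap.zero_apply]

theorem cartanClass_skew {i j : ZMod 2} {a b : S} (ha : a ∈ 𝒮 i) (hb : b ∈ 𝒮 j) (p q : ι) :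
    m.cartanClass p q a b + koszulSign k i j • m.cartanClass q p b a = 0 :=
  g.wedgeClass_skew (m.unit_mem ha p q) (m.unit_mem hb q p)

/-- The derivation rule for `E_pq(a) ∧ [E_qr(b), E_rp(c)]`. Together with skew-symmetry, it yields
all the relations among Cartan classes below. -/
theorem cartanClass_mul {i j l : ZMod 2} {a b c : S} (ha : a ∈ 𝒮 i) (hb : b ∈ 𝒮 j) (hc : c ∈ 𝒮 l)
    {p q r : ι} (hpq : p ≠ q) (hqr : q ≠ r) (hpr : p ≠ r) :
    m.cartanClass p q a (b * c) = m.cartanClass p r (a * b) c -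
      (koszulSign k i j * koszulSign k i l) • m.cartanClass q r b (c * a) := by
  have h := g.wedgeClass_bracket (m.unit_mem ha p q) (m.unit_mem hb q r) (m.unit_mem hc r p)
  rw [m.bracket_unit_unit hb hc hqr hpr.symm hpq.symm, m.bracket_unit_unit ha hb hpq hqr hpr,
    m.bracket_unit_unit' ha hc hpr.symm hpq hqr.symm, map_neg, map_smul, smul_neg, smul_smul] at h
  rw [cartanClass_apply, h, sub_eq_add_neg]
  rfl

/-- The case `b = c = 1`. It mirrors the additivity of the differentials `E_pp(a) - E_qq(a)`. -/
theorem cartanClass_one_cocycle {i : ZMod 2} {a : S} (ha : a ∈ 𝒮 i) {p q r : ι} (hpq : p ≠ q)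
    (hqr : q ≠ r) (hpr : p ≠ r) :
    m.cartanClass p q a 1 = m.cartanClass p r a 1 + m.cartanClass r q a 1 := by
  have h1 := SetLike.one_mem_graded 𝒮
  have h := m.cartanClass_mul ha h1 h1 hpq hqr hpr
  have h' := m.cartanClass_skew ha h1 r q
  simp only [mul_one, one_mul, koszulSign_zero_right, one_smul] at h h'
  linear_combination (norm := module) h - h'

theorem cartanClass_one_neg {i : ZMod 2} {a : S} (ha : a ∈ 𝒮 i) {p q r : ι} (hpq : p ≠ q)
    (hqr : q ≠ r) (hpr : p ≠ r) : m.cartanClass q r a 1 = -m.cartanClass r q a 1 := by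
  have h := m.cartanClass_one_cocycle ha hpq hqr hpr
  have h' := m.cartanClass_one_cocycle ha hpr hqr.symm hpq
  linear_combination (norm := module) -h - h'

end MatrixModel

end Model

/-! ### Normal form of the Cartan classes, and the pairing with values in `(S ⊗ S) / I_S`. -/

section ModelClasses

variable {k S L ι : Type*} [CommRing k] [Ring S] [Algebra k S] [Fintype ι] [DecidableEq ι]
  [AddCommGroup L] [Module k L]

namespace MatrixModel

variable {𝒮 : ZMod 2 → Submodule k S} [GradedAlgebra 𝒮] {g : LieSuperalgebra k L}
  (m : MatrixModel 𝒮 g ι)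

/-- The class with differential `[a, b]` at the diagonal entry `o`, as the cyclic pairing. -/
def diagClass (o o' : ι) : S →ₗ[k] S →ₗ[k] g.Wedge2 ⧸ g.boundaries :=
  m.cartanClass o' o - (LinearMap.mul k S).compr₂ ((m.cartanClass o' o).flip 1)

theorem diagClass_apply (o o' : ι) (a b : S) :
    m.diagClass o o' a b = m.cartanClass o' o a b - m.cartanClass o' o (a * b) 1 := rfl

variable {o o' : ι}

/-- The auxiliary index `o'` in `diagClass` is immaterial: the triple `(a, b, 1)` along `p, o, o'`
and the cocycle rule replace `o'` by `p`. -/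
theorem cartanClass_base {i j : ZMod 2} {a b : S} (ha : a ∈ 𝒮 i) (hb : b ∈ 𝒮 j) (ho : o' ≠ o)
    {p : ι} (hp : p ≠ o) :
    m.cartanClass p o a b = m.diagClass o o' a b + m.cartanClass p o (a * b) 1 := by
  rw [diagClass_apply]
  by_cases hp' : p = o'
  · subst hp'
    abel
  · have h := m.cartanClass_mul ha hb (SetLike.one_mem_graded 𝒮) hp ho.symm hp'
    have s := m.cartanClass_skew ha hb o' o
    have c := m.cartanClass_one_cocycle (SetLike.mul_mem_graded ha hb) hp' ho hp
    have n := m.cartanClass_one_neg (SetLike.mul_mem_graded ha hb) hp' ho hp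
    simp only [mul_one, one_mul, koszulSign_zero_right] at h
    linear_combination (norm := module) h - s + c + n

/-- Going from `E_o'o(a) ∧ E_oo'(b)` to `E_o'r(a) ∧ E_ro'(b)` and expanding the latter at `o`
exchanges `a` and `b`. A third index `r` is needed. -/
theorem diagClass_skew (hι : ∀ p q : ι, ∃ r, r ≠ p ∧ r ≠ q) {i j : ZMod 2} {a b : S}
    (ha : a ∈ 𝒮 i) (hb : b ∈ 𝒮 j) (ho : o' ≠ o) :
    m.diagClass o o' a b + koszulSign k i j • m.diagClass o o' b a = 0 := by
  obtain ⟨r, hro, hro'⟩ := hι o o'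
  have h1 := SetLike.one_mem_graded 𝒮
  have e1 := m.cartanClass_mul ha h1 hb ho hro.symm hro'.symm
  have e2 := m.cartanClass_mul ha hb h1 hro'.symm hro ho
  have s := m.cartanClass_skew h1 (SetLike.mul_mem_graded hb ha) o r
  have b1 := m.cartanClass_base ha hb ho ho
  have b2 := m.cartanClass_base hb ha ho hro
  simp only [mul_one, one_mul, koszulSign_zero_right, koszulSign_zero_left, one_smul]
    at e1 e2 s
  linear_combination (norm := module) e1 + e2 - koszulSign k i j • s - b1 - koszulSign k i j • b2

/-- The normal form: the first term sees only `⟨a, b⟩`, and the others see only the diagonal entries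
of `[E_pq(a), E_qp(b)]`. -/
theorem cartanClass_eq (hι : ∀ p q : ι, ∃ r, r ≠ p ∧ r ≠ q) {i j : ZMod 2} {a b : S}
    (ha : a ∈ 𝒮 i) (hb : b ∈ 𝒮 j) (ho : o' ≠ o) {p q : ι} (hpq : p ≠ q) :
    m.cartanClass p q a b = m.diagClass o o' a b + m.cartanClass p o (a * b) 1 -
      koszulSign k i j • m.cartanClass q o (b * a) 1 := by
  have hs := m.diagClass_skew hι ha hb ho
  by_cases hq : q = o
  · subst hq
    rw [m.cartanClass_base ha hb ho hpq, cartanClass_self, smul_zero, sub_zero]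
  · have s := m.cartanClass_skew ha hb o q
    have b1 := m.cartanClass_base hb ha ho hq
    by_cases hp : p = o
    · subst hp
      rw [cartanClass_self]
      linear_combination (norm := module) s - koszulSign k i j • b1 - hs
    · have e := m.cartanClass_mul ha hb (SetLike.one_mem_graded 𝒮) hpq hq hp
      simp only [mul_one, one_mul, koszulSign_zero_right] at e
      linear_combination (norm := module) e - koszulSign k i j • b1 - hs

/-- Put every term of `cartanClass_mul` along `o', r, o` into normal form. The terms with second
argument `1` cancel, leaving three diagonal classes. -/
theorem diagClass_cyclic (hι : ∀ p q : ι, ∃ r, r ≠ p ∧ r ≠ q) {i j l : ZMod 2} {a b c : S}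
    (ha : a ∈ 𝒮 i) (hb : b ∈ 𝒮 j) (hc : c ∈ 𝒮 l) (ho : o' ≠ o) :
    koszulSign k i l • m.diagClass o o' (a * b) c +
      koszulSign k j i • m.diagClass o o' (b * c) a +
      koszulSign k l j • m.diagClass o o' (c * a) b = 0 := by
  obtain ⟨r, hro, hro'⟩ := hι o o'
  have e := m.cartanClass_mul ha hb hc hro'.symm hro ho
  have f1 := m.cartanClass_eq hι ha (SetLike.mul_mem_graded hb hc) ho hro'.symm
  have f2 := m.cartanClass_base (SetLike.mul_mem_graded ha hb) hc ho ho
  have f3 := m.cartanClass_base hb (SetLike.mul_mem_graded hc ha) ho hro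
  have s1 := m.diagClass_skew hι ha (SetLike.mul_mem_graded hb hc) ho
  have s2 := m.diagClass_skew hι hb (SetLike.mul_mem_graded hc ha) ho
  simp only [mul_assoc] at e f1 f2 f3 s1 s2
  rcases zmod_two_cases i with rfl | rfl <;> rcases zmod_two_cases j with rfl | rfl <;>
    rcases zmod_two_cases l with rfl | rfl <;>
    simp only [zero_add, add_zero, zmod_two_one_add_one, koszulSign_zero_left,
      koszulSign_zero_right, koszulSign_one_one] at e f1 f2 f3 s1 s2 ⊢
  · linear_combination (norm := module) -e + f1 - f2 + f3 + s1 + s2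
  · linear_combination (norm := module) -e + f1 - f2 + f3 + s1 + s2
  · linear_combination (norm := module) -e + f1 - f2 + f3 + s1 + s2
  · linear_combination (norm := module) -e + f1 - f2 + f3 + s1 + s2
  · linear_combination (norm := module) -e + f1 - f2 + f3 + s1 + s2
  · linear_combination (norm := module) e - f1 + f2 + f3 - s1 + s2
  · linear_combination (norm := module) -e + f1 - f2 - f3 + s1 - s2
  · linear_combination (norm := module) e - f1 + f2 - f3 - s1 - s2

/-- The map `⟨a, b⟩ ↦ diagClass a b` on `(S ⊗ S) / I_S`. -/
def diagLift (hι : ∀ p q : ι, ∃ r, r ≠ p ∧ r ≠ q) (ho : o' ≠ o) :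
    ((S ⊗[k] S) ⧸ cyclicRelations 𝒮) →ₗ[k] g.Wedge2 ⧸ g.boundaries :=
  cyclicLift 𝒮 (m.diagClass o o') (fun _ _ _ ha _ hb => m.diagClass_skew hι ha hb ho)
    (fun _ _ _ _ ha _ hb _ hc => m.diagClass_cyclic hι ha hb hc ho)

/-- The class with a given matrix as differential, up to the trace. -/
def matrixClass (o : ι) : Matrix ι ι S →ₗ[k] g.Wedge2 ⧸ g.boundaries :=
  ∑ p, ∑ q, m.unitClass p q ∘ₗ Matrix.entryLinearMap k S p q +
    ∑ p, (m.cartanClass p o).flip 1 ∘ₗ Matrix.entryLinearMap k S p p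

theorem matrixClass_single (o p q : ι) (a : S) : m.matrixClass o (Matrix.single p q a) =
    if p = q then m.cartanClass p o a 1 else m.unitClass p q a := by
  have e1 : ∑ u, ∑ v, m.unitClass u v (Matrix.single p q a u v) = m.unitClass p q a := by
    rw [Finset.sum_eq_single p, Finset.sum_eq_single q, Matrix.single_apply_same]
    · intro v _ hv
      rw [Matrix.single_apply_of_col_ne _ _ hv.symm, map_zero]
    · simp
    · intro u _ hu
      refine Finset.sum_eq_zero fun v _ => ?_
      rw [Matrix.single_apply_of_row_ne hu.symm, map_zero]
    · simp
  have e2 : ∑ u, m.cartanClass u o (Matrix.single p q a u u) 1 =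
      if p = q then m.cartanClass p o a 1 else 0 := by
    rw [Finset.sum_eq_single p]
    · split_ifs with h
      · subst h
        rw [Matrix.single_apply_same]
      · rw [Matrix.single_apply_of_col_ne _ _ (Ne.symm h), map_zero, LinearMap.zero_apply]
    · intro u _ hu
      rw [Matrix.single_apply_of_row_ne hu.symm, map_zero, LinearMap.zero_apply]
    · simp
  have e3 : m.matrixClass o (Matrix.single p q a) =
      ∑ u, ∑ v, m.unitClass u v (Matrix.single p q a u v) +
        ∑ u, m.cartanClass u o (Matrix.single p q a u u) 1 := by
    simp [matrixClass, LinearMap.sum_apply]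
  rw [e3, e1, e2]
  split_ifs with h
  · subst h
    rw [unitClass, unit_self, LinearMap.comp_zero, LinearMap.zero_apply, zero_add]
  · rw [add_zero]

/-- The map `x ∧ y ↦ ∑ ⟨x p q, y q p⟩`. -/
def pairing : g.Wedge2 ⧸ g.boundaries →ₗ[k] ((S ⊗[k] S) ⧸ cyclicRelations 𝒮) :=
  g.wedgeLift ((tracePair 𝒮).compl₁₂ m.toMatrix m.toMatrix)
    (fun _ _ _ hx _ hy => tracePair_skew 𝒮 (m.mem_grading.1 hx) (m.mem_grading.1 hy))
    (by
      intro i j l x hx y hy z hz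
      have X := m.mem_grading.1 hx
      have Y := m.mem_grading.1 hy
      have Z := m.mem_grading.1 hz
      -- Expanding the supercommutators splits the Jacobi sum into the cyclic relations of `X, Y, Z`
      -- and of `Y, X, Z`.
      have h := tracePair_cyclic 𝒮 X Y Z
      have h' := tracePair_cyclic 𝒮 Y X Z
      simp only [LinearMap.compl₁₂_apply, m.bracket hx hy, m.bracket hy hz, m.bracket hz hx,
        map_sub, map_smul, LinearMap.sub_apply, LinearMap.smul_apply]
      rcases zmod_two_cases i with rfl | rfl <;> rcases zmod_two_cases j with rfl | rfl <;>
        rcases zmod_two_cases l with rfl | rfl <;>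
        simp only [koszulSign_zero_left, koszulSign_zero_right, koszulSign_one_one] at h h' ⊢
      · linear_combination (norm := module) h - h'
      · linear_combination (norm := module) h - h'
      · linear_combination (norm := module) h - h'
      · linear_combination (norm := module) h + h'
      · linear_combination (norm := module) h - h'
      · linear_combination (norm := module) h + h'
      · linear_combination (norm := module) h + h'
      · linear_combination (norm := module) h + h')
    (by
      intro x hx
      have X := m.mem_grading.1 hx
      -- For odd `x` the bracket `[x, x]` has matrix `X² + X²`.
      simp only [LinearMap.compl₁₂_apply, m.bracket hx hx, koszulSign_one_one, neg_smul, one_smul,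
        sub_neg_eq_add, map_add, LinearMap.add_apply, tracePair_cube 𝒮 X (m.trace_mem x), add_zero])

theorem pairing_wedgeClass (x y : L) :
    m.pairing (g.wedgeClass x y) = tracePair 𝒮 (m.toMatrix x) (m.toMatrix y) := rfl

/-- Hence cycles have pairing in `HC₁(S)`. -/
theorem cyclicCommutator_pairing (u : g.Wedge2 ⧸ g.boundaries) :
    cyclicCommutator 𝒮 (m.pairing u) = (m.toMatrix (g.d2Class u)).trace := by
  suffices h : cyclicCommutator 𝒮 ∘ₗ m.pairing =
      Matrix.traceLinearMap ι k S ∘ₗ m.toMatrix ∘ₗ g.d2Class from LinearMap.congr_fun h u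
  refine g.wedgeQuotient_ext fun x y => ?_
  have := g.ext_homogeneous₂
    (f := g.wedgeClass.compr₂ (cyclicCommutator 𝒮 ∘ₗ m.pairing))
    (f' := g.wedgeClass.compr₂ (Matrix.traceLinearMap ι k S ∘ₗ m.toMatrix ∘ₗ g.d2Class)) ?_
  · exact LinearMap.congr_fun₂ this x y
  · intro i j x hx y hy
    simp only [LinearMap.compr₂_apply, LinearMap.comp_apply, pairing_wedgeClass,
      g.d2Class_wedgeClass, m.bracket hx hy, Matrix.traceLinearMap_apply]
    exact cyclicCommutator_tracePair 𝒮 (m.mem_grading.1 hx) (m.mem_grading.1 hy)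

end MatrixModel

end ModelClasses

/-! ### Homogeneous tensors. -/

section Tensor

variable {k M N M' N' : Type*} [CommRing k] [AddCommGroup M] [Module k M] [AddCommGroup N]
  [Module k N] [AddCommGroup M'] [Module k M'] [AddCommGroup N'] [Module k N']

theorem superTensorGrading_le {ℳ : ZMod 2 → Submodule k M} {𝒩 : ZMod 2 → Submodule k N}
    {i : ZMod 2} {P : Submodule k (M ⊗[k] N)}
    (h : ∀ a b, a + b = i → ∀ x ∈ ℳ a, ∀ y ∈ 𝒩 b, x ⊗ₜ[k] y ∈ P) :
    superTensorGrading ℳ 𝒩 i ≤ P := by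
  refine Submodule.span_le.2 ?_
  rintro _ ⟨a, b, hab, x, hx, y, hy, rfl⟩
  exact h a b hab x hx y hy

theorem tmul_mem_superTensorGrading {ℳ : ZMod 2 → Submodule k M} {𝒩 : ZMod 2 → Submodule k N}
    {i a b : ZMod 2} (hab : a + b = i) {x : M} (hx : x ∈ ℳ a) {y : N} (hy : y ∈ 𝒩 b) :
    x ⊗ₜ[k] y ∈ superTensorGrading ℳ 𝒩 i :=
  Submodule.subset_span ⟨a, b, hab, x, hx, y, hy, rfl⟩

end Tensor

/-! ### Second homology of a Lie superalgebra of matrices: injectivity of the pairing and lifting of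
tensors. -/

section ModelHomology

variable {k S L ι : Type*} [CommRing k] [Ring S] [Algebra k S] [Fintype ι] [DecidableEq ι]
  [AddCommGroup L] [Module k L]

theorem LieSuperalgebra.H2_induction (g : LieSuperalgebra k L) {P : g.H2 → Prop}
    (h : ∀ u : g.cycles, P ((g.boundaries.submoduleOf g.cycles).mkQ u)) (x : g.H2) : P x := by
  obtain ⟨u, rfl⟩ := Submodule.mkQ_surjective _ x
  exact h u

/-- The inclusion of the second homology into the exterior square modulo boundaries. -/
def LieSuperalgebra.H2Inclusion (g : LieSuperalgebra k L) :
    g.H2 →ₗ[k] g.Wedge2 ⧸ g.boundaries :=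
  Submodule.mapQ _ _ g.cycles.subtype
    (show g.boundaries.submoduleOf g.cycles ≤ g.boundaries.comap g.cycles.subtype from le_rfl)

theorem LieSuperalgebra.H2Inclusion_mkQ (g : LieSuperalgebra k L) (u : g.cycles) :
    g.H2Inclusion ((g.boundaries.submoduleOf g.cycles).mkQ u) = g.boundaries.mkQ u := rfl

theorem LieSuperalgebra.H2Inclusion_injective (g : LieSuperalgebra k L) :
    Function.Injective g.H2Inclusion := by
  refine (injective_iff_map_eq_zero _).2 (g.H2_induction fun u hu => ?_)
  rw [H2Inclusion_mkQ] at hu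
  have hu' : (u : g.Wedge2) ∈ g.boundaries := (Submodule.Quotient.mk_eq_zero g.boundaries).1 hu
  exact (Submodule.Quotient.mk_eq_zero _).2 hu'

theorem LieSuperalgebra.d2Class_H2Inclusion (g : LieSuperalgebra k L) (x : g.H2) :
    g.d2Class (g.H2Inclusion x) = 0 :=
  g.H2_induction (P := fun x => g.d2Class (g.H2Inclusion x) = 0) (fun u => u.2) x

namespace MatrixModel

variable {𝒮 : ZMod 2 → Submodule k S} [GradedAlgebra 𝒮] {g : LieSuperalgebra k L}
  (m : MatrixModel 𝒮 g ι)

/-- The elements `E_{pq}(a)` with `p ≠ q` and `a` homogeneous. -/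
def units : Set L := {x | ∃ i, ∃ p q : ι, p ≠ q ∧ ∃ a ∈ 𝒮 i, x = m.unit p q a}

/-- The elements `[E_{pq}(a), E_{qp}(b)]` with `p ≠ q` and `a`, `b` homogeneous. -/
def cartans : Set L := {x | ∃ i j, ∃ p q : ι, p ≠ q ∧ ∃ a ∈ 𝒮 i, ∃ b ∈ 𝒮 j,
  x = g.bracket (m.unit p q a) (m.unit q p b)}

theorem unit_mem_span (p q : ι) (a : S) : m.unit p q a ∈ Submodule.span k (m.units ∪ m.cartans) := by
  by_cases h : p = q
  · subst h
    rw [unit_self]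
    exact zero_mem _
  · rw [← proj_add_proj 𝒮 a, map_add]
    exact add_mem (Submodule.subset_span (Or.inl ⟨0, p, q, h, _, proj_mem 𝒮 0 a, rfl⟩))
      (Submodule.subset_span (Or.inl ⟨1, p, q, h, _, proj_mem 𝒮 1 a, rfl⟩))

theorem bracket_unit_unit_one_mem_span (p q : ι) (a : S) :
    g.bracket (m.unit p q a) (m.unit q p 1) ∈ Submodule.span k (m.units ∪ m.cartans) := by
  by_cases h : p = q
  · subst h
    rw [unit_self, LinearMap.zero_apply, map_zero, LinearMap.zero_apply]
    exact zero_mem _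
  · have h1 := SetLike.one_mem_graded 𝒮
    rw [← proj_add_proj 𝒮 a, map_add, map_add, LinearMap.add_apply]
    exact add_mem
      (Submodule.subset_span (Or.inr ⟨0, 0, p, q, h, _, proj_mem 𝒮 0 a, 1, h1, rfl⟩))
      (Submodule.subset_span (Or.inr ⟨1, 0, p, q, h, _, proj_mem 𝒮 1 a, 1, h1, rfl⟩))

theorem exists_mem_span_of_mem_commutatorSpan {o o' : ι} (ho : o' ≠ o) {t : S}
    (ht : t ∈ commutatorSpan 𝒮) : ∃ y ∈ Submodule.span k (m.units ∪ m.cartans),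
      m.toMatrix y = Matrix.single o o t := by
  suffices commutatorSpan 𝒮 ≤ ((Submodule.span k (m.units ∪ m.cartans)).map m.toMatrix).comap
      (Matrix.singleLinearMap k o o) by
    exact this ht
  refine Submodule.span_le.2 ?_
  rintro _ ⟨i, j, a, ha, b, hb, rfl⟩
  -- The two brackets share the entry `ab` at `(o', o')`. Their difference leaves `[a, b]` at `(o,
  -- o)`.
  refine ⟨g.bracket (m.unit o' o a) (m.unit o o' b) -
    g.bracket (m.unit o' o (a * b)) (m.unit o o' 1), sub_mem (Submodule.subset_span
      (Or.inr ⟨i, j, o', o, ho, a, ha, b, hb, rfl⟩)) (m.bracket_unit_unit_one_mem_span _ _ _), ?_⟩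
  rw [map_sub, m.toMatrix_bracket_unit_unit ha hb ho, m.toMatrix_bracket_unit_unit_one _ ho,
    superCommutator_of_mem 𝒮 ha hb, map_sub, map_smul]
  simp only [Matrix.singleLinearMap_apply]
  abel

theorem toMatrix_unit_eq (p q : ι) (a : S) : m.toMatrix (m.unit p q a) =
    Matrix.single p q a - if p = q then Matrix.single p q a else 0 := by
  split_ifs with h
  · subst h
    rw [unit_self, LinearMap.zero_apply, map_zero, sub_self]
  · rw [m.toMatrix_unit h, sub_zero]

theorem toMatrix_bracket_unit_unit_one_eq (p q : ι) (a : S) :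
    m.toMatrix (g.bracket (m.unit p q a) (m.unit q p 1)) =
      Matrix.single p p a - Matrix.single q q a := by
  by_cases h : p = q
  · subst h
    rw [unit_self, LinearMap.zero_apply, map_zero, LinearMap.zero_apply, map_zero, sub_self]
  · exact m.toMatrix_bracket_unit_unit_one a h

theorem span_units_cartans {o o' : ι} (ho : o' ≠ o) :
    Submodule.span k (m.units ∪ m.cartans) = ⊤ := by
  rw [eq_top_iff]
  intro x _
  obtain ⟨y, hy, hyx⟩ := m.exists_mem_span_of_mem_commutatorSpan ho (m.trace_mem x)
  -- Matrix units account for the off-diagonal part, and Cartan elements move each diagonal entry to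
  -- `(o, o)`. What remains there is the trace, realized by `y`.
  have e : x = ∑ p, ∑ q, m.unit p q (m.toMatrix x p q) +
      ∑ p, g.bracket (m.unit p o (m.toMatrix x p p)) (m.unit o p 1) + y := by
    apply m.injective
    have hs : ∑ p, Matrix.single o o (m.toMatrix x p p) =
        Matrix.single o o (m.toMatrix x).trace :=
      (map_sum (Matrix.singleLinearMap k o o) _ _).symm
    simp only [map_add, map_sum, toMatrix_unit_eq, toMatrix_bracket_unit_unit_one_eq, hyx,
      Finset.sum_sub_distrib, Finset.sum_ite_eq, Finset.mem_univ, if_true, hs,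
      ← Matrix.matrix_eq_sum_single (m.toMatrix x)]
    abel
  rw [e]
  exact add_mem (add_mem (sum_mem fun p _ => sum_mem fun q _ => m.unit_mem_span _ _ _)
    (sum_mem fun p _ => m.bracket_unit_unit_one_mem_span _ _ _)) hy

theorem bracket_diagonal_unit {i j : ZMod 2} {x : L} {d : ι → S} (hx : x ∈ g.grading i)
    (hd : m.toMatrix x = Matrix.diagonal d) {a : S} (ha : a ∈ 𝒮 j) {p q : ι} (hpq : p ≠ q) :
    ∃ b ∈ 𝒮 (i + j), g.bracket x (m.unit p q a) = m.unit p q b := by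
  have hdi : ∀ p, d p ∈ 𝒮 i := fun p => by
    simpa [hd] using m.mem_grading.1 hx p p
  refine ⟨d p * a - koszulSign k i j • (a * d q), sub_mem (SetLike.mul_mem_graded (hdi p) ha)
    (Submodule.smul_mem _ _ (add_comm j i ▸ SetLike.mul_mem_graded ha (hdi q))), ?_⟩
  apply m.injective
  rw [m.bracket hx (m.unit_mem ha p q), m.toMatrix_unit hpq, m.toMatrix_unit hpq, hd]
  ext u v
  rw [Matrix.sub_apply, Matrix.smul_apply, Matrix.diagonal_mul, Matrix.mul_diagonal]
  simp only [Matrix.single_apply]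
  split_ifs with h
  · rw [h.1, h.2]
  · simp

/-- The candidate for an inverse of `u ↦ (d u, pairing u)`, composed with that map. -/
def retraction {o o' : ι} (hι : ∀ p q : ι, ∃ r, r ≠ p ∧ r ≠ q) (ho : o' ≠ o) :
    g.Wedge2 ⧸ g.boundaries →ₗ[k] g.Wedge2 ⧸ g.boundaries :=
  m.matrixClass o ∘ₗ m.toMatrix ∘ₗ g.d2Class + m.diagLift hι ho ∘ₗ m.pairing

section Retraction

variable {o o' : ι} (hι : ∀ p q : ι, ∃ r, r ≠ p ∧ r ≠ q) (ho : o' ≠ o)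

theorem retraction_wedgeClass (x y : L) : m.retraction hι ho (g.wedgeClass x y) =
    m.matrixClass o (m.toMatrix (g.bracket x y)) +
      m.diagLift hι ho (tracePair 𝒮 (m.toMatrix x) (m.toMatrix y)) := rfl

/-- For `p = s` this is the normal form `cartanClass_eq`. For `p ≠ s` the pairing vanishes and the
bracket determines the class. -/
theorem retraction_unit_unit_of_eq {i j : ZMod 2} {a b : S} (ha : a ∈ 𝒮 i) (hb : b ∈ 𝒮 j)
    {p q s : ι} (hpq : p ≠ q) (hqs : q ≠ s) :
    m.retraction hι ho (g.wedgeClass (m.unit p q a) (m.unit q s b)) =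
      g.wedgeClass (m.unit p q a) (m.unit q s b) := by
  rw [retraction_wedgeClass, m.toMatrix_unit hpq, m.toMatrix_unit hqs, tracePair_single_single]
  by_cases hps : p = s
  · subst hps
    rw [if_pos ⟨rfl, rfl⟩, m.toMatrix_bracket_unit_unit ha hb hpq, map_sub, map_smul,
      matrixClass_single, matrixClass_single, if_pos rfl, if_pos rfl, ← cartanClass_apply,
      m.cartanClass_eq hι ha hb ho hpq, diagLift, cyclicLift_cyclicPair]
    abel
  · rw [if_neg fun h => hps h.1, map_zero, add_zero, m.bracket_unit_unit ha hb hpq hqs hps,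
      m.wedgeClass_unit_unit ha hb hpq hqs hps, m.toMatrix_unit hps, matrixClass_single,
      if_neg hps]

theorem retraction_unit_unit (h2 : IsUnit (2 : k)) {i j : ZMod 2} {a b : S} (ha : a ∈ 𝒮 i) (hb : b ∈ 𝒮 j)
    {p q r s : ι} (hpq : p ≠ q) (hrs : r ≠ s) :
    m.retraction hι ho (g.wedgeClass (m.unit p q a) (m.unit r s b)) =
      g.wedgeClass (m.unit p q a) (m.unit r s b) := by
  by_cases hqr : q = r
  · subst hqr
    exact m.retraction_unit_unit_of_eq hι ho ha hb hpq hrs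
  · by_cases hps : p = s
    · subst hps
      have h := m.retraction_unit_unit_of_eq hι ho hb ha hrs hpq
      rw [eq_neg_of_add_eq_zero_left (g.wedgeClass_skew (m.unit_mem ha p q) (m.unit_mem hb r p)),
        map_neg, map_smul, h]
    · rw [m.wedgeClass_unit_unit_of_ne h2 ha hb hpq hrs hqr hps, map_zero]

/-- Bracketing with a diagonal element preserves each position, so the derivation rule leads back to
wedges of matrix units. -/
theorem retraction_diagonal_bracket (h2 : IsUnit (2 : k)) {i j l : ZMod 2} {x : L} {d : ι → S} (hx : x ∈ g.grading i)
    (hd : m.toMatrix x = Matrix.diagonal d) {a b : S} (ha : a ∈ 𝒮 j) (hb : b ∈ 𝒮 l)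
    {p q r s : ι} (hpq : p ≠ q) (hrs : r ≠ s) :
    m.retraction hι ho (g.wedgeClass x (g.bracket (m.unit p q a) (m.unit r s b))) =
      g.wedgeClass x (g.bracket (m.unit p q a) (m.unit r s b)) := by
  obtain ⟨a', ha', ea⟩ := m.bracket_diagonal_unit hx hd ha hpq
  obtain ⟨b', hb', eb⟩ := m.bracket_diagonal_unit hx hd hb hrs
  rw [g.wedgeClass_bracket hx (m.unit_mem ha p q) (m.unit_mem hb r s), ea, eb, map_add, map_smul,
    m.retraction_unit_unit hι ho h2 ha' hb hpq hrs, m.retraction_unit_unit hι ho h2 ha hb' hpq hrs]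

theorem cartans_diagonal {x : L} (hx : x ∈ m.cartans) :
    ∃ i, x ∈ g.grading i ∧ ∃ d, m.toMatrix x = Matrix.diagonal d := by
  obtain ⟨i, j, p, q, hpq, a, ha, b, hb, rfl⟩ := hx
  refine ⟨i + j, g.bracket_mem (m.unit_mem ha p q) (m.unit_mem hb q p),
    Pi.single p (a * b) - koszulSign k i j • (Pi.single q (b * a) : ι → S), ?_⟩
  rw [m.toMatrix_bracket_unit_unit ha hb hpq, ← Matrix.diagonal_single, ← Matrix.diagonal_single,
    ← Matrix.diagonal_smul, Matrix.diagonal_sub]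
  rfl

theorem retraction_cartan_unit (h2 : IsUnit (2 : k)) {x y : L} (hx : x ∈ m.cartans) (hy : y ∈ m.units) :
    m.retraction hι ho (g.wedgeClass x y) = g.wedgeClass x y := by
  obtain ⟨i, hxi, d, hd⟩ := m.cartans_diagonal hx
  obtain ⟨j, p, q, hpq, a, ha, rfl⟩ := hy
  -- A third index writes `E_pq(a)` as `[E_pr(a), E_rq(1)]`.
  obtain ⟨r, hrp, hrq⟩ := hι p q
  have h1 := SetLike.one_mem_graded 𝒮
  have h := m.retraction_diagonal_bracket hι ho h2 hxi hd ha h1 hrp.symm hrq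
  rwa [m.bracket_unit_unit ha h1 hrp.symm hrq hpq, mul_one] at h

/-- It suffices to test wedges of generators. When both factors are Cartan elements, the second is
by definition a bracket of matrix units, so `retraction_diagonal_bracket` applies. -/
theorem retraction_apply (h2 : IsUnit (2 : k)) (u : g.Wedge2 ⧸ g.boundaries) : m.retraction hι ho u = u := by
  suffices h : m.retraction hι ho = LinearMap.id from LinearMap.congr_fun h u
  refine g.wedgeQuotient_ext fun x y => ?_
  suffices h : g.wedgeClass.compr₂ (m.retraction hι ho) = g.wedgeClass from
    LinearMap.congr_fun₂ h x y
  refine LinearMap.ext_on (m.span_units_cartans ho) fun x hx =>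
    LinearMap.ext_on (m.span_units_cartans ho) fun y hy => ?_
  rw [LinearMap.compr₂_apply]
  rcases hx with hx | hx <;> rcases hy with hy | hy
  · obtain ⟨i, p, q, hpq, a, ha, rfl⟩ := hx
    obtain ⟨j, r, s, hrs, b, hb, rfl⟩ := hy
    exact m.retraction_unit_unit hι ho h2 ha hb hpq hrs
  · have h := m.retraction_cartan_unit hι ho h2 hy hx
    obtain ⟨i, p, q, hpq, a, ha, rfl⟩ := hx
    obtain ⟨j, hyj, -⟩ := m.cartans_diagonal hy
    rw [eq_neg_of_add_eq_zero_left (g.wedgeClass_skew (m.unit_mem ha p q) hyj), map_neg, map_smul,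
      h]
  · exact m.retraction_cartan_unit hι ho h2 hx hy
  · obtain ⟨i, hxi, d, hd⟩ := m.cartans_diagonal hx
    obtain ⟨j, l, p, q, hpq, a, ha, b, hb, rfl⟩ := hy
    exact m.retraction_diagonal_bracket hι ho h2 hxi hd ha hb hpq hpq.symm

end Retraction

theorem eq_zero_of_pairing_eq_zero {o o' : ι} (hι : ∀ p q : ι, ∃ r, r ≠ p ∧ r ≠ q) (ho : o' ≠ o)
    (h2 : IsUnit (2 : k)) {u : g.Wedge2 ⧸ g.boundaries} (hd : g.d2Class u = 0)
    (hp : m.pairing u = 0) : u = 0 := by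
  rw [← m.retraction_apply hι ho h2 u, retraction, LinearMap.add_apply, LinearMap.comp_apply,
    LinearMap.comp_apply, LinearMap.comp_apply, hd, hp]
  simp

/-! ### Lifting tensors to cycles -/

/-- The tensor `E_{pq}(a) ⊗ E_{qp}(b) - E_{pq}(ab) ⊗ E_{qp}(1)`. -/
def liftTensor (p q : ι) : S ⊗[k] S →ₗ[k] L ⊗[k] L :=
  TensorProduct.map (m.unit p q) (m.unit q p) ∘ₗ
    (LinearMap.id - (TensorProduct.mk k S S).flip 1 ∘ₗ LinearMap.mul' k S)

theorem liftTensor_tmul (p q : ι) (a b : S) : m.liftTensor p q (a ⊗ₜ b) =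
    m.unit p q a ⊗ₜ m.unit q p b - m.unit p q (a * b) ⊗ₜ m.unit q p 1 := by
  simp [liftTensor]

theorem liftTensor_mem (p q : ι) {i : ZMod 2} {t : S ⊗[k] S} (ht : t ∈ superTensorGrading 𝒮 𝒮 i) :
    m.liftTensor p q t ∈ superTensorGrading g.grading g.grading i := by
  refine superTensorGrading_le (P := (superTensorGrading g.grading g.grading i).comap
    (m.liftTensor p q)) (fun a b hab x hx y hy => ?_) ht
  rw [Submodule.mem_comap, liftTensor_tmul]
  exact sub_mem (tmul_mem_superTensorGrading hab (m.unit_mem hx p q) (m.unit_mem hy q p))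
    (tmul_mem_superTensorGrading (add_zero i)
      (m.unit_mem (hab ▸ SetLike.mul_mem_graded hx hy) p q)
      (m.unit_mem (SetLike.one_mem_graded 𝒮) q p))

theorem tensor_ext_homogeneous {M : Type*} [AddCommGroup M] [Module k M]
    {f f' : S ⊗[k] S →ₗ[k] M} (h : ∀ i j, ∀ a ∈ 𝒮 i, ∀ b ∈ 𝒮 j, f (a ⊗ₜ b) = f' (a ⊗ₜ b)) :
    f = f' := by
  have := bilinear_ext_homogeneous 𝒮 (f := (TensorProduct.mk k S S).compr₂ f)
    (g := (TensorProduct.mk k S S).compr₂ f') h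
  exact TensorProduct.ext this

/-- The correction term of `liftTensor` is invisible to the pairing, because `⟨ab, 1⟩ = 0`. -/
theorem pairing_liftTensor {p q : ι} (hpq : p ≠ q) (t : S ⊗[k] S) :
    m.pairing (g.boundaries.mkQ (g.skewRelations.mkQ (m.liftTensor p q t))) =
      (cyclicRelations 𝒮).mkQ t := by
  suffices h : m.pairing ∘ₗ g.boundaries.mkQ ∘ₗ g.skewRelations.mkQ ∘ₗ m.liftTensor p q =
      (cyclicRelations 𝒮).mkQ from LinearMap.congr_fun h t
  refine TensorProduct.ext' fun a b => ?_
  have e : g.boundaries.mkQ (g.skewRelations.mkQ (m.liftTensor p q (a ⊗ₜ b))) =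
      g.wedgeClass (m.unit p q a) (m.unit q p b) -
        g.wedgeClass (m.unit p q (a * b)) (m.unit q p 1) := by
    rw [liftTensor_tmul, map_sub, map_sub]
    rfl
  rw [LinearMap.comp_apply, LinearMap.comp_apply, LinearMap.comp_apply, e, map_sub,
    pairing_wedgeClass, pairing_wedgeClass, m.toMatrix_unit hpq, m.toMatrix_unit hpq,
    m.toMatrix_unit hpq.symm, m.toMatrix_unit hpq.symm, tracePair_single_single,
    tracePair_single_single, if_pos ⟨rfl, rfl⟩, if_pos ⟨rfl, rfl⟩, cyclicPair_one_right, sub_zero]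
  rfl

/-- The correction term cancels the entry `ab` at `(p, p)`, so tensors representing classes in
`HC₁(S)` lift to cycles. -/
theorem d2_liftTensor {p q : ι} (hpq : p ≠ q) (t : S ⊗[k] S) :
    m.toMatrix (g.d2 (g.skewRelations.mkQ (m.liftTensor p q t))) =
      Matrix.single q q (cyclicCommutator 𝒮 ((cyclicRelations 𝒮).mkQ t)) := by
  suffices h : m.toMatrix ∘ₗ g.d2 ∘ₗ g.skewRelations.mkQ ∘ₗ m.liftTensor p q =
      Matrix.singleLinearMap k q q ∘ₗ cyclicCommutator 𝒮 ∘ₗ (cyclicRelations 𝒮).mkQ from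
    LinearMap.congr_fun h t
  refine tensor_ext_homogeneous (𝒮 := 𝒮) fun i j a ha b hb => ?_
  have e : g.d2 (g.skewRelations.mkQ (m.liftTensor p q (a ⊗ₜ b))) =
      g.bracket (m.unit p q a) (m.unit q p b) -
        g.bracket (m.unit p q (a * b)) (m.unit q p 1) := by
    rw [liftTensor_tmul, map_sub, map_sub]
    rfl
  rw [LinearMap.comp_apply, LinearMap.comp_apply, LinearMap.comp_apply, e, LinearMap.comp_apply,
    LinearMap.comp_apply, mkQ_tmul, cyclicCommutator_cyclicPair, superCommutator_of_mem 𝒮 ha hb,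
    map_sub, m.toMatrix_bracket_unit_unit ha hb hpq, m.toMatrix_bracket_unit_unit_one _ hpq,
    map_sub, map_smul]
  simp only [Matrix.singleLinearMap_apply]
  abel

theorem pairing_mem {i : ZMod 2} {t : L ⊗[k] L} (ht : t ∈ superTensorGrading g.grading g.grading i) :
    m.pairing (g.boundaries.mkQ (g.skewRelations.mkQ t)) ∈
      (superTensorGrading 𝒮 𝒮 i).map (cyclicRelations 𝒮).mkQ := by
  refine superTensorGrading_le (P := ((superTensorGrading 𝒮 𝒮 i).map (cyclicRelations 𝒮).mkQ).comap
    (m.pairing ∘ₗ g.boundaries.mkQ ∘ₗ g.skewRelations.mkQ)) (fun a b hab x hx y hy => ?_) ht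
  change tracePair 𝒮 (m.toMatrix x) (m.toMatrix y) ∈
    (superTensorGrading 𝒮 𝒮 i).map (cyclicRelations 𝒮).mkQ
  rw [tracePair_apply]
  exact sum_mem fun p _ => sum_mem fun q _ => Submodule.mem_map_of_mem
    (tmul_mem_superTensorGrading hab (m.mem_grading.1 hx p q) (m.mem_grading.1 hy q p))

end MatrixModel

end ModelHomology

/-! ## The special queer Lie superalgebra as a Lie superalgebra of matrices over `R ⊕ R ν` -/

section QueerModel

variable {k R : Type*} [CommRing k] [Ring R] [Algebra k R]
  (𝓡 : ZMod 2 → Submodule k R) [GradedAlgebra 𝓡] (n : ℕ)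

namespace QueerDouble

/-- The matrix `A + B ν` formed by the upper blocks `A`, `B` of a block matrix. -/
def ofBlocks : Matrix (Fin n ⊕ Fin n) (Fin n ⊕ Fin n) R →ₗ[k]
    Matrix (Fin n) (Fin n) (QueerDouble 𝓡) where
  toFun X := Matrix.of fun p q => inl 𝓡 (X (Sum.inl p) (Sum.inl q)) + inr 𝓡 (X (Sum.inl p) (Sum.inr q))
  map_add' X Y := by
    ext p q <;> simp
  map_smul' c X := by
    ext p q <;> simp

/-- The block matrix `(A, B; ρ(B), ρ(A))` of `A + B ν`. -/
def toBlocks (X : Matrix (Fin n) (Fin n) (QueerDouble 𝓡)) :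
    Matrix (Fin n ⊕ Fin n) (Fin n ⊕ Fin n) R :=
  Matrix.fromBlocks (X.map (fst 𝓡)) (X.map (snd 𝓡)) ((X.map (snd 𝓡)).map (parityMap 𝓡))
    ((X.map (fst 𝓡)).map (parityMap 𝓡))

variable {n}

theorem toBlocks_mem (X : Matrix (Fin n) (Fin n) (QueerDouble 𝓡)) :
    toBlocks 𝓡 n X ∈ queerSub 𝓡 n := ⟨_, _, rfl⟩

theorem ofBlocks_toBlocks (X : Matrix (Fin n) (Fin n) (QueerDouble 𝓡)) :
    ofBlocks 𝓡 n (toBlocks 𝓡 n X) = X := by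
  ext p q <;> simp [ofBlocks, toBlocks]

theorem toBlocks_ofBlocks {X : Matrix (Fin n ⊕ Fin n) (Fin n ⊕ Fin n) R}
    (hX : X ∈ queerSub 𝓡 n) : toBlocks 𝓡 n (ofBlocks 𝓡 n X) = X := by
  obtain ⟨A, B, rfl⟩ := hX
  ext (p | p) (q | q) <;> simp [ofBlocks, toBlocks]

/-- The upper blocks of `X * Y` involve only the upper blocks of `X`, so the queer form is required
of `Y` alone. The rule `ν a = ρ(a) ν` reproduces the lower blocks of `Y`. -/
theorem ofBlocks_mul (X : Matrix (Fin n ⊕ Fin n) (Fin n ⊕ Fin n) R)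
    {Y : Matrix (Fin n ⊕ Fin n) (Fin n ⊕ Fin n) R} (hY : Y ∈ queerSub 𝓡 n) :
    ofBlocks 𝓡 n (X * Y) = ofBlocks 𝓡 n X * ofBlocks 𝓡 n Y := by
  obtain ⟨A, B, rfl⟩ := hY
  ext p q <;> simp [ofBlocks, Matrix.mul_apply, fst_mul, snd_mul, Finset.sum_add_distrib]

theorem mem_matrixGrading_iff {X : Matrix (Fin n ⊕ Fin n) (Fin n ⊕ Fin n) R}
    (hX : X ∈ queerSub 𝓡 n) {i : ZMod 2} :
    X ∈ matrixGrading 𝓡 n n i ↔ ∀ p q, ofBlocks 𝓡 n X p q ∈ grading 𝓡 i := by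
  have h11 : i + (1 + 1) = i := by rw [zmod_two_one_add_one, add_zero]
  constructor
  · intro h p q
    have h1 := h (Sum.inl p) (Sum.inl q)
    have h2 := h (Sum.inl p) (Sum.inr q)
    simp only [blockParity, Sum.elim_inl, Sum.elim_inr, add_zero, zero_add] at h1 h2
    exact add_mem (inl_mem 𝓡 h1) (⟨(𝓡 i).zero_mem, h2⟩ : inr 𝓡 _ ∈ grading 𝓡 i)
  · intro h
    rw [← toBlocks_ofBlocks 𝓡 hX]
    rintro (p | p) (q | q)
    · simpa [blockParity, toBlocks] using (h p q).1
    · simpa [blockParity, toBlocks] using (h p q).2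
    · simpa [blockParity, toBlocks] using parityMap_mem 𝓡 (h p q).2
    · simpa [blockParity, toBlocks, h11] using parityMap_mem 𝓡 (h p q).1

theorem ofBlocks_superCommutator {i j : ZMod 2} {X Y : Matrix (Fin n ⊕ Fin n) (Fin n ⊕ Fin n) R}
    (hX : X ∈ queerSub 𝓡 n) (hY : Y ∈ queerSub 𝓡 n) (hXi : X ∈ matrixGrading 𝓡 n n i)
    (hYj : Y ∈ matrixGrading 𝓡 n n j) :
    ofBlocks 𝓡 n (superCommutator (matrixGrading 𝓡 n n) X Y) =
      ofBlocks 𝓡 n X * ofBlocks 𝓡 n Y -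
        koszulSign k i j • (ofBlocks 𝓡 n Y * ofBlocks 𝓡 n X) := by
  rw [superCommutator_of_mem _ hXi hYj, map_sub, map_smul, ofBlocks_mul 𝓡 _ hY,
    ofBlocks_mul 𝓡 _ hX]

theorem trace_commutator_mem {S ι : Type*} [Ring S] [Algebra k S] [Fintype ι] [DecidableEq ι]
    (𝒮 : ZMod 2 → Submodule k S) [GradedAlgebra 𝒮] {i j : ZMod 2} {X Y : Matrix ι ι S}
    (hX : ∀ p q, X p q ∈ 𝒮 i) (hY : ∀ p q, Y p q ∈ 𝒮 j) :
    (X * Y - koszulSign k i j • (Y * X)).trace ∈ commutatorSpan 𝒮 := by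
  rw [← cyclicCommutator_tracePair 𝒮 hX hY, tracePair_apply]
  simp only [map_sum, cyclicCommutator_cyclicPair]
  exact sum_mem fun p _ => sum_mem fun q _ =>
    Submodule.subset_span ⟨i, j, _, hX p q, _, hY q p, rfl⟩

theorem specialQueerSub_le : specialQueerSub 𝓡 n ≤ queerSub 𝓡 n := by
  refine Submodule.span_le.2 ?_
  rintro _ ⟨X, hX, Y, hY, rfl⟩
  exact (isSub_queerSub 𝓡 n).bracket_mem X hX Y hY

theorem trace_ofBlocks_mem {X : Matrix (Fin n ⊕ Fin n) (Fin n ⊕ Fin n) R}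
    (hX : X ∈ specialQueerSub 𝓡 n) :
    (ofBlocks 𝓡 n X).trace ∈ commutatorSpan (grading 𝓡) := by
  suffices specialQueerSub 𝓡 n ≤ (commutatorSpan (grading 𝓡)).comap
      (Matrix.traceLinearMap (Fin n) k (QueerDouble 𝓡) ∘ₗ ofBlocks 𝓡 n) from this hX
  refine Submodule.span_le.2 ?_
  rintro _ ⟨X, hX, Y, hY, rfl⟩
  have key : ∀ i j, ∀ X ∈ queerSub 𝓡 n ⊓ matrixGrading 𝓡 n n i,
      ∀ Y ∈ queerSub 𝓡 n ⊓ matrixGrading 𝓡 n n j,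
      superCommutator (matrixGrading 𝓡 n n) X Y ∈ (commutatorSpan (grading 𝓡)).comap
      (Matrix.traceLinearMap (Fin n) k (QueerDouble 𝓡) ∘ₗ ofBlocks 𝓡 n) := by
    intro i j X hX Y hY
    rw [Submodule.mem_comap, LinearMap.comp_apply, ofBlocks_superCommutator 𝓡 hX.1 hY.1 hX.2 hY.2]
    exact trace_commutator_mem _ ((mem_matrixGrading_iff 𝓡 hX.1).1 hX.2)
      ((mem_matrixGrading_iff 𝓡 hY.1).1 hY.2)
  obtain ⟨x0, hx0, x1, hx1, rfl⟩ := Submodule.mem_sup.1 ((isSub_queerSub 𝓡 n).homogeneous hX)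
  obtain ⟨y0, hy0, y1, hy1, rfl⟩ := Submodule.mem_sup.1 ((isSub_queerSub 𝓡 n).homogeneous hY)
  simp only [map_add, LinearMap.add_apply]
  exact add_mem (add_mem (key _ _ _ hx0 _ hy0) (key _ _ _ hx1 _ hy0))
    (add_mem (key _ _ _ hx0 _ hy1) (key _ _ _ hx1 _ hy1))

theorem exists_commutator {i j : ZMod 2} {X Y : Matrix (Fin n) (Fin n) (QueerDouble 𝓡)}
    (hX : ∀ p q, X p q ∈ grading 𝓡 i) (hY : ∀ p q, Y p q ∈ grading 𝓡 j) :
    ∃ Z ∈ specialQueerSub 𝓡 n, ofBlocks 𝓡 n Z = X * Y - koszulSign k i j • (Y * X) := by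
  refine ⟨superCommutator (matrixGrading 𝓡 n n) (toBlocks 𝓡 n X) (toBlocks 𝓡 n Y),
    Submodule.subset_span ⟨_, toBlocks_mem 𝓡 X, _, toBlocks_mem 𝓡 Y, rfl⟩, ?_⟩
  rw [ofBlocks_superCommutator 𝓡 (i := i) (j := j) (toBlocks_mem 𝓡 X) (toBlocks_mem 𝓡 Y),
    ofBlocks_toBlocks, ofBlocks_toBlocks]
  · rw [mem_matrixGrading_iff 𝓡 (toBlocks_mem 𝓡 X), ofBlocks_toBlocks]
    exact hX
  · rw [mem_matrixGrading_iff 𝓡 (toBlocks_mem 𝓡 Y), ofBlocks_toBlocks]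
    exact hY

theorem exists_ofBlocks_eq_single {p q : Fin n} (hpq : p ≠ q) (a : QueerDouble 𝓡) :
    ∃ Z ∈ specialQueerSub 𝓡 n, ofBlocks 𝓡 n Z = Matrix.single p q a := by
  have key : ∀ i, ∀ a ∈ grading 𝓡 i, ∃ Z ∈ specialQueerSub 𝓡 n,
      ofBlocks 𝓡 n Z = Matrix.single p q a := by
    intro i a ha
    obtain ⟨Z, hZ, e⟩ := exists_commutator 𝓡
      (MatrixModel.single_mem (SetLike.one_mem_graded (grading 𝓡)) p p)
      (MatrixModel.single_mem ha p q)
    refine ⟨Z, hZ, ?_⟩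
    rw [e, Matrix.single_mul_single_same, Matrix.single_mul_single_of_ne _ _ _ _ hpq.symm, one_mul,
      smul_zero, sub_zero]
  obtain ⟨Y, hY, eY⟩ := key 0 _ (proj_mem (grading 𝓡) 0 a)
  obtain ⟨Z, hZ, eZ⟩ := key 1 _ (proj_mem (grading 𝓡) 1 a)
  refine ⟨Y + Z, add_mem hY hZ, ?_⟩
  rw [map_add, eY, eZ, ← Matrix.single_add, proj_add_proj]

/-- `[E_pp(ν), E_pp(ν)] = 2 E_pp(1)`, as `ν` is odd with `ν² = 1`. This supplies the weight argument
with its diagonal idempotents. -/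
theorem exists_ofBlocks_eq_single_one (h2 : IsUnit (2 : k)) (p : Fin n) :
    ∃ Z ∈ specialQueerSub 𝓡 n, ofBlocks 𝓡 n Z = Matrix.single p p 1 := by
  have hν : inr 𝓡 (1 : R) ∈ grading 𝓡 1 :=
    inr_mem_of_eq 𝓡 (SetLike.one_mem_graded 𝓡) (zero_add 1)
  obtain ⟨Z, hZ, e⟩ := exists_commutator 𝓡 (MatrixModel.single_mem hν p p)
    (MatrixModel.single_mem hν p p)
  obtain ⟨c, hc⟩ := h2.exists_left_inv
  refine ⟨c • Z, Submodule.smul_mem _ c hZ, ?_⟩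
  rw [map_smul, e, Matrix.single_mul_single_same, inr_mul_inr, parityMap_one, mul_one, ← one_def,
    koszulSign_one_one, neg_smul, one_smul, sub_neg_eq_add, ← two_smul k, smul_smul, hc, one_smul]

/-- `𝔰𝔮ₙ(R)` as a Lie superalgebra of matrices over `R ⊕ R ν`. -/
def specialQueerModel (h2 : IsUnit (2 : k)) :
    MatrixModel (grading 𝓡) (specialQueer 𝓡 n) (Fin n) where
  toMatrix := ofBlocks 𝓡 n ∘ₗ (specialQueerSub 𝓡 n).subtype
  injective := by
    intro X Y h
    refine Subtype.ext ?_
    rw [← toBlocks_ofBlocks 𝓡 (specialQueerSub_le 𝓡 X.2),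
      ← toBlocks_ofBlocks 𝓡 (specialQueerSub_le 𝓡 Y.2)]
    exact congrArg _ h
  mem_grading {i X} := mem_matrixGrading_iff 𝓡 (specialQueerSub_le 𝓡 X.2)
  bracket {i j X Y} hX hY := ofBlocks_superCommutator 𝓡 (specialQueerSub_le 𝓡 X.2)
    (specialQueerSub_le 𝓡 Y.2) hX hY
  trace_mem X := trace_ofBlocks_mem 𝓡 X.2
  exists_single hpq a := by
    obtain ⟨Z, hZ, e⟩ := exists_ofBlocks_eq_single 𝓡 hpq a
    exact ⟨⟨Z, hZ⟩, e⟩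
  exists_single_one p := by
    obtain ⟨Z, hZ, e⟩ := exists_ofBlocks_eq_single_one 𝓡 h2 p
    exact ⟨⟨Z, hZ⟩, e⟩

/-! ### Second homology -/

theorem oddPart_mem {i : ZMod 2}
    {u : (QueerDouble 𝓡 ⊗[k] QueerDouble 𝓡) ⧸ cyclicRelations (grading 𝓡)}
    (hu : u ∈ (superTensorGrading (grading 𝓡) (grading 𝓡) i).map (cyclicRelations (grading 𝓡)).mkQ) :
    oddPart 𝓡 u ∈ (superTensorGrading 𝓡 𝓡 (i + 1)).map (cyclicRelations 𝓡).mkQ := by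
  obtain ⟨t, ht, rfl⟩ := hu
  refine superTensorGrading_le (P := ((superTensorGrading 𝓡 𝓡 (i + 1)).map
    (cyclicRelations 𝓡).mkQ).comap (oddPart 𝓡 ∘ₗ (cyclicRelations (grading 𝓡)).mkQ))
    (fun a b hab x hx y hy => ?_) ht
  rw [Submodule.mem_comap, LinearMap.comp_apply, mkQ_tmul, oddPart_cyclicPair]
  refine add_mem (Submodule.mem_map_of_mem (tmul_mem_superTensorGrading ?_ hx.1 hy.2))
    (Submodule.mem_map_of_mem (tmul_mem_superTensorGrading ?_ hx.2 (parityMap_mem 𝓡 hy.1)))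
  · rw [← hab, add_assoc]
  · rw [← hab, add_right_comm]

/-- The map from `H₂(𝔰𝔮ₙ(R))` to `⟨R, R⟩`. -/
def H2ToCyclic (h2 : IsUnit (2 : k)) :
    (specialQueer 𝓡 n).H2 →ₗ[k] ((R ⊗[k] R) ⧸ cyclicRelations 𝓡) :=
  oddPart 𝓡 ∘ₗ (specialQueerModel 𝓡 h2).pairing ∘ₗ (specialQueer 𝓡 n).H2Inclusion

theorem cyclicCommutator_pairing_H2 (h2 : IsUnit (2 : k)) (x : (specialQueer 𝓡 n).H2) :
    cyclicCommutator (grading 𝓡)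
      ((specialQueerModel 𝓡 h2).pairing ((specialQueer 𝓡 n).H2Inclusion x)) = 0 := by
  rw [MatrixModel.cyclicCommutator_pairing, LieSuperalgebra.d2Class_H2Inclusion, map_zero,
    Matrix.trace_zero]

theorem H2ToCyclic_mem (h2 : IsUnit (2 : k)) (x : (specialQueer 𝓡 n).H2) :
    H2ToCyclic 𝓡 h2 x ∈ HC1 𝓡 := by
  rw [LinearMap.mem_ker, H2ToCyclic, LinearMap.comp_apply, LinearMap.comp_apply,
    cyclicCommutator_oddPart, cyclicCommutator_pairing_H2, map_zero]

theorem H2ToCyclic_injective (h2 : IsUnit (2 : k)) (hn : 3 ≤ n) :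
    Function.Injective (H2ToCyclic (n := n) 𝓡 h2) := by
  refine (injective_iff_map_eq_zero _).2 fun x hx => ?_
  have hι : ∀ p q : Fin n, ∃ r, r ≠ p ∧ r ≠ q := by
    intro p q
    obtain ⟨r, hr⟩ := Finset.exists_mem_notMem_of_card_lt_card
      (s := {p, q}) (t := (Finset.univ : Finset (Fin n)))
      (Finset.card_le_two.trans_lt (by rw [Finset.card_univ, Fintype.card_fin]; omega))
    exact ⟨r, by simpa using hr⟩
  have ho : (⟨1, by omega⟩ : Fin n) ≠ ⟨0, by omega⟩ := by simp
  refine (specialQueer 𝓡 n).H2Inclusion_injective ?_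
  rw [map_zero]
  exact (specialQueerModel 𝓡 h2).eq_zero_of_pairing_eq_zero hι ho h2
    ((specialQueer 𝓡 n).d2Class_H2Inclusion x)
    (eq_zero_of_oddPart_eq_zero 𝓡 h2 (cyclicCommutator_pairing_H2 𝓡 h2 x) hx)

/-- A tensor representing a class in `HC₁(R)` lifts to `H₂(𝔰𝔮ₙ(R))`. -/
theorem exists_H2ToCyclic_eq (h2 : IsUnit (2 : k)) (hn : 3 ≤ n) (t : R ⊗[k] R)
    (ht : (cyclicRelations 𝓡).mkQ t ∈ HC1 𝓡) :
    ∃ x : (specialQueer 𝓡 n).H2, H2ToCyclic 𝓡 h2 x = (cyclicRelations 𝓡).mkQ t ∧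
      ∀ i, t ∈ superTensorGrading 𝓡 𝓡 (i + 1) → x ∈ (specialQueer 𝓡 n).H2Grading i := by
  have hpq : (⟨0, by omega⟩ : Fin n) ≠ ⟨1, by omega⟩ := by simp
  set m := specialQueerModel (n := n) 𝓡 h2
  -- Replacing `a ⊗ b` by `a ⊗ b ν` gives a tensor with odd part `⟨a, b⟩`. Its commutator has no
  -- `R`-component, and its `ν`-component vanishes as `t` represents a class in `HC₁(R)`.
  set t' := TensorProduct.map (inl 𝓡) (inr 𝓡) t
  have e1 : oddPart 𝓡 ((cyclicRelations (grading 𝓡)).mkQ t') = (cyclicRelations 𝓡).mkQ t := by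
    suffices h : oddPart 𝓡 ∘ₗ (cyclicRelations (grading 𝓡)).mkQ ∘ₗ
        TensorProduct.map (inl 𝓡) (inr 𝓡) = (cyclicRelations 𝓡).mkQ from LinearMap.congr_fun h t
    refine TensorProduct.ext' fun a b => ?_
    rw [LinearMap.comp_apply, LinearMap.comp_apply, TensorProduct.map_tmul, mkQ_tmul,
      oddPart_cyclicPair, mkQ_tmul]
    simp
  have e2 : fst 𝓡 (cyclicCommutator (grading 𝓡) ((cyclicRelations (grading 𝓡)).mkQ t')) = 0 := by
    suffices h : fst 𝓡 ∘ₗ cyclicCommutator (grading 𝓡) ∘ₗ (cyclicRelations (grading 𝓡)).mkQ ∘ₗ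
        TensorProduct.map (inl 𝓡) (inr 𝓡) = 0 from LinearMap.congr_fun h t
    refine MatrixModel.tensor_ext_homogeneous (𝒮 := 𝓡) fun i j a ha b hb => ?_
    rw [LinearMap.comp_apply, LinearMap.comp_apply, LinearMap.comp_apply, TensorProduct.map_tmul,
      mkQ_tmul, cyclicCommutator_cyclicPair,
      superCommutator_of_mem _ (inl_mem 𝓡 ha) (inr_mem 𝓡 hb), inl_mul_inr, inr_mul_inl]
    simp
  have e3 : cyclicCommutator (grading 𝓡) ((cyclicRelations (grading 𝓡)).mkQ t') = 0 := by
    refine QueerDouble.ext (by rw [e2, map_zero]) ?_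
    rw [← cyclicCommutator_oddPart, e1, map_zero]
    exact ht
  have hu : (specialQueer 𝓡 n).skewRelations.mkQ (m.liftTensor ⟨0, by omega⟩ ⟨1, by omega⟩ t') ∈
      (specialQueer 𝓡 n).cycles := by
    refine m.injective ?_
    rw [m.d2_liftTensor hpq, e3, Matrix.single_zero, map_zero]
  refine ⟨((specialQueer 𝓡 n).boundaries.submoduleOf (specialQueer 𝓡 n).cycles).mkQ ⟨_, hu⟩, ?_, ?_⟩
  · rw [H2ToCyclic, LinearMap.comp_apply, LinearMap.comp_apply, LieSuperalgebra.H2Inclusion_mkQ,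
      m.pairing_liftTensor hpq, e1]
  · intro i hi
    have ht' : t' ∈ superTensorGrading (grading 𝓡) (grading 𝓡) i := by
      refine superTensorGrading_le (P := (superTensorGrading (grading 𝓡) (grading 𝓡) i).comap
        (TensorProduct.map (inl 𝓡) (inr 𝓡))) (fun a b hab x hx y hy => ?_) hi
      rw [Submodule.mem_comap, TensorProduct.map_tmul]
      refine tmul_mem_superTensorGrading ?_ (inl_mem 𝓡 hx) (inr_mem 𝓡 hy)
      rw [← add_assoc, hab, add_assoc, zmod_two_one_add_one, add_zero]
    exact Submodule.mem_map_of_mem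
      (Submodule.mem_map_of_mem (m.liftTensor_mem _ _ ht'))

theorem H2ToCyclic_mem_grading (h2 : IsUnit (2 : k)) {i : ZMod 2} {x : (specialQueer 𝓡 n).H2}
    (hx : x ∈ (specialQueer 𝓡 n).H2Grading i) :
    H2ToCyclic 𝓡 h2 x ∈ (superTensorGrading 𝓡 𝓡 (i + 1)).map (cyclicRelations 𝓡).mkQ := by
  obtain ⟨u, ⟨t, ht, hu⟩, rfl⟩ := hx
  refine oddPart_mem 𝓡 ?_
  rw [LinearMap.comp_apply, LieSuperalgebra.H2Inclusion_mkQ]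
  have := (specialQueerModel 𝓡 h2).pairing_mem ht
  rw [hu] at this
  exact this

/-- The isomorphism of `H₂(𝔰𝔮ₙ(R))` with `HC₁(R)`, which reverses parities. -/
def H2EquivHC1 (h2 : IsUnit (2 : k)) (hn : 3 ≤ n) : (specialQueer 𝓡 n).H2 ≃ₗ[k] HC1 𝓡 :=
  LinearEquiv.ofBijective ((H2ToCyclic 𝓡 h2).codRestrict (HC1 𝓡) (H2ToCyclic_mem 𝓡 h2)) <| by
    constructor
    · exact fun x y h => H2ToCyclic_injective 𝓡 h2 hn (congrArg Subtype.val h)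
    · rintro ⟨w, hw⟩
      obtain ⟨t, rfl⟩ := Submodule.mkQ_surjective _ w
      obtain ⟨x, hx, -⟩ := exists_H2ToCyclic_eq 𝓡 h2 hn t hw
      exact ⟨x, Subtype.ext hx⟩

theorem map_H2EquivHC1 (h2 : IsUnit (2 : k)) (hn : 3 ≤ n) (i : ZMod 2) :
    ((specialQueer 𝓡 n).H2Grading i).map (H2EquivHC1 𝓡 h2 hn).toLinearMap =
      HC1Grading 𝓡 (i + 1) := by
  refine le_antisymm ?_ ?_
  · rintro _ ⟨x, hx, rfl⟩
    exact H2ToCyclic_mem_grading 𝓡 h2 hx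
  · rintro ⟨w, hw⟩ ⟨t, ht, htw⟩
    obtain rfl : (cyclicRelations 𝓡).mkQ t = w := htw
    obtain ⟨x, hx, hxi⟩ := exists_H2ToCyclic_eq 𝓡 h2 hn t hw
    exact ⟨x, hxi i ht, Subtype.ext hx⟩

end QueerDouble

end QueerModel

/-! ### Tensoring with the odd line as a parity shift, and the conclusion. -/

theorem map_rid_symm_eq_superTensorGrading {k M : Type*} [CommRing k] [AddCommGroup M] [Module k M]
    (ℳ : ZMod 2 → Submodule k M) (i : ZMod 2) :
    (ℳ (i + 1)).map (TensorProduct.rid k M).symm.toLinearMap =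
      superTensorGrading ℳ (oddLine k) i := by
  refine le_antisymm ?_ (superTensorGrading_le fun a b hab x hx y hy => ?_)
  · rintro _ ⟨x, hx, rfl⟩
    refine tmul_mem_superTensorGrading (b := 1) ?_ hx (by simp [oddLine])
    rw [add_assoc, zmod_two_one_add_one, add_zero]
  · rcases zmod_two_cases b with rfl | rfl
    · obtain rfl : y = 0 := by simpa [oddLine] using hy
      rw [TensorProduct.tmul_zero]
      exact zero_mem _
    · have ha : a = i + 1 := by rw [← hab, add_assoc, zmod_two_one_add_one, add_zero]
      refine ⟨y • x, ha ▸ Submodule.smul_mem _ y hx, ?_⟩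
      simp [← TensorProduct.tmul_smul]

end

theorem mainTheorem1 {k R : Type*} [CommRing k] (h2 : IsUnit (2 : k)) [Ring R] [Algebra k R]
    (𝓡 : ZMod 2 → Submodule k R) [GradedAlgebra 𝓡] (n : ℕ) (hn : 3 ≤ n) :
    ∃ e : (specialQueer 𝓡 n).H2 ≃ₗ[k] (HC1 𝓡) ⊗[k] k,
      ∀ i : ZMod 2, ((specialQueer 𝓡 n).H2Grading i).map e.toLinearMap =
        superTensorGrading (HC1Grading 𝓡) (oddLine k) i := by
  refine ⟨(QueerDouble.H2EquivHC1 𝓡 h2 hn).trans (TensorProduct.rid k (HC1 𝓡)).symm, fun i => ?_⟩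
  rw [← map_rid_symm_eq_superTensorGrading, ← QueerDouble.map_H2EquivHC1 𝓡 h2 hn i,
    ← Submodule.map_comp]
  rfl
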